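/- Let $N$ be an integer, $L$ a positive integer and $f$ a real-valued function with five continuous derivatives on $[N+1,N+L]$. Suppose there are constants $W_5>1$ and $\lambda_5\ge 1$ such that $$\frac1{W_5}\le |f^{(5)}(x)|\le\frac{\lambda_5}{W_5}\qquad (N+1\le x\le N+L)$$ (if $L=1$, the interval is a single point and no condition is imposed). Then for all real $\eta_3,\eta_4,\eta_5>0$, $$\left|\sum_{n=N+1}^{N+L}e^{2\pi i f(n)}\right|^2\le (LW_5^{-1/15}+\eta_5)\left(\alpha_5L+\tau_5L^{3/4}W_5^{2/15}+\gamma_5L^{1/2}W_5^{1/5}+\omega_5L^{1/4}W_5^{1/5}+\beta_5W_5^{4/15}\right),$$ where $$\alpha_5=\frac1{\eta_5}+\frac{392}{435}\sqrt{\widetilde\alpha_4}\,\bigl(\eta_5+W_5^{-1/15}\bigr)^{1/14},\qquad \tau_5=\frac{392}{351}\sqrt{\widetilde\gamma_4}\,\eta_5^{-1/14},\qquad \gamma_5=\frac{98}{78}\sqrt{\beta_4}\,\eta_5^{-1/7}+\sqrt{\eta_4\widetilde\alpha_4}\,W_5^{-2/15},$$ $$\omega_5=\frac{98}{78}\sqrt{\eta_4\widetilde\gamma_4}\,\eta_5^{-1/7},\qquad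 \beta_5=\frac{392}{275}\sqrt{\eta_4\beta_4}\,\eta_5^{-3/14},$$ and $$\widetilde\alpha_4=\frac1{\eta_4}+\frac{72}{91}\sqrt{\widetilde\alpha_3}\,(\eta_4+1)^{1/6},\qquad \widetilde\gamma_4=\frac{72}{55}\sqrt{\widetilde\beta_3}\,\eta_4^{-1/6}+\sqrt{\eta_3\widetilde\alpha_3},\qquad \beta_4=\frac{18}{10}\sqrt{\widetilde\beta_3\eta_3}\,\eta_4^{-1/3},$$ $$\widetilde\alpha_3=\frac1{\eta_3}+\frac{32\lambda_5}{15\sqrt\pi}\sqrt{\eta_3+1}+2\lambda_5\eta_3+2\lambda_5,\qquad \widetilde\beta_3=\frac{64}{3\sqrt\pi\sqrt{\eta_3}}+4.$$ -/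

import Mathlib

namespace FifthDerivativeTest

noncomputable section

/-- `α̃₃`, depending on the free parameter `η₃` and on the ratio `lam` of the derivative bounds. -/
def alphaTilde3 (η₃ lam : ℝ) : ℝ :=
  1 / η₃ + 32 * lam / (15 * √Real.pi) * √(η₃ + 1) + 2 * lam * η₃ + 2 * lam

/-- `β̃₃`. -/
def betaTilde3 (η₃ : ℝ) : ℝ :=
  64 / (3 * √Real.pi * √η₃) + 4

/-- `α̃₄`. -/
def alphaTilde4 (η₃ η₄ lam : ℝ) : ℝ :=
  1 / η₄ + 72 / 91 * √(alphaTilde3 η₃ lam) * (η₄ + 1) ^ (1 / 6 : ℝ)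

/-- `γ̃₄`. -/
def gammaTilde4 (η₃ η₄ lam : ℝ) : ℝ :=
  72 / 55 * √(betaTilde3 η₃) * η₄ ^ (-(1 / 6) : ℝ) + √(η₃ * alphaTilde3 η₃ lam)

/-- `β₄`. -/
def beta4 (η₃ η₄ : ℝ) : ℝ :=
  18 / 10 * √(betaTilde3 η₃ * η₃) * η₄ ^ (-(1 / 3) : ℝ)

/-- `α₅`. -/
def alpha5 (η₃ η₄ η₅ lam W : ℝ) : ℝ :=
  1 / η₅ + 392 / 435 * √(alphaTilde4 η₃ η₄ lam) * (η₅ + W ^ (-(1 / 15) : ℝ)) ^ (1 / 14 : ℝ)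

/-- `τ₅`. -/
def tau5 (η₃ η₄ η₅ lam : ℝ) : ℝ :=
  392 / 351 * √(gammaTilde4 η₃ η₄ lam) * η₅ ^ (-(1 / 14) : ℝ)

/-- `γ₅`. -/
def gamma5 (η₃ η₄ η₅ lam W : ℝ) : ℝ :=
  98 / 78 * √(beta4 η₃ η₄) * η₅ ^ (-(1 / 7) : ℝ)
    + √(η₄ * alphaTilde4 η₃ η₄ lam) * W ^ (-(2 / 15) : ℝ)

/-- `ω₅`. -/
def omega5 (η₃ η₄ η₅ lam : ℝ) : ℝ :=
  98 / 78 * √(η₄ * gammaTilde4 η₃ η₄ lam) * η₅ ^ (-(1 / 7) : ℝ)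

/-- `β₅`. -/
def beta5 (η₃ η₄ η₅ : ℝ) : ℝ :=
  392 / 275 * √(η₄ * beta4 η₃ η₄) * η₅ ^ (-(3 / 14) : ℝ)

end

end FifthDerivativeTest

/-!
The bound is the result of three Weyl–van der Corput differencings followed by a Kusmin–Landau
estimate. All of it depends on `f` only through the forward differences of the samples
`a n = f (N + 1 + n)`, so that everything after the first reduction concerns finite real sequences
with two-sided bounds on a forward difference of some order (`DiffBounds`).

* *Reduction.* By the mean value theorem (`fwdDiff_iter_mem_of_hasDerivWithinAt`) and the constancy
  of the sign of the fifth derivative, the fifth differences of `a` or of `-a` lie in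
  `[1 / W, lam / W]`; replacing `a` by `-a` conjugates the sum (`diffBounds_or_diffBounds_neg`).
* *Order two.* If the second differences lie in `[A, B]`, the increments of `a` increase slowly, and
  they meet at most `B L + 2` unit intervals. In each, at most `2 (Δ / A + 1)` increments are within
  `Δ` of an endpoint, and the others contribute at most `2 / (π Δ)` by `kusmin_landau`. The choice
  `Δ = √(A / π)` gives `second_difference_test`.
* *Raising the order.* Differencing with shift `m` lowers the order by one and multiplies the bounds
  by `m` (`DiffBounds.shift_sub`). With `⌈η W ^ κ⌉` shifts, `weyl_van_der_corput` reduces the sum to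
  triangularly weighted sums of powers `m ^ p`, which are at most the corresponding integrals
  `M ^ (p + 2) / ((p + 1) (p + 2))` (`sum_weight_mul_rpow_le`); this is `differencing_step`. With
  `κ = 1 / 3, 1 / 7, 1 / 15` it yields the tests of orders three, four and five; the square root of
  the previous bound is expanded by subadditivity into four, respectively six, powers of `m`.

The differenced sums call the test of lower order with `W / m` in place of `W`, which may be less
than `1`; there the third and fourth tests hold because they are weaker than the trivial bound.
-/

namespace FifthDerivativeTest

/-! ### Additive characters and the Kusmin–Landau inequality -/

/-- The additive character `e(x) = exp (2πix)` of the real line. -/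
noncomputable def e (x : ℝ) : ℂ := Complex.exp (2 * (Real.pi : ℂ) * Complex.I * (x : ℂ))

lemma norm_e (x : ℝ) : ‖e x‖ = 1 := by
  have : 2 * (Real.pi : ℂ) * Complex.I * (x : ℂ) = ((2 * Real.pi * x : ℝ) : ℂ) * Complex.I := by
    push_cast; ring
  rw [e, this, Complex.norm_exp_ofReal_mul_I]

lemma e_add (x y : ℝ) : e (x + y) = e x * e y := by
  rw [e, e, e, ← Complex.exp_add]; push_cast; ring_nf

lemma e_intCast (k : ℤ) : e k = 1 := by
  rw [e, ← Complex.exp_int_mul_two_pi_mul_I k]; push_cast; ring_nf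

lemma e_neg (x : ℝ) : e (-x) = (starRingEnd ℂ) (e x) := by
  rw [e, e, ← Complex.exp_conj]; simp [Complex.conj_ofNat]

lemma e_sub (x y : ℝ) : e (x - y) = e x * (starRingEnd ℂ) (e y) := by
  rw [sub_eq_add_neg, e_add, e_neg]

/-- `1 / (1 - e(x / π))`, written as `(1 + i cot x) / 2`. -/
noncomputable def cotFactor (x : ℝ) : ℂ :=
  ((1 / 2 : ℝ) : ℂ) + ((Real.cos x / (2 * Real.sin x) : ℝ) : ℂ) * Complex.I

lemma cotFactor_mul {h : ℝ} (hs : Real.sin (Real.pi * h) ≠ 0) :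
    cotFactor (Real.pi * h) * (1 - e h) = 1 := by
  have h1 : e h = ((Real.cos (2 * (Real.pi * h)) : ℝ) : ℂ)
      + ((Real.sin (2 * (Real.pi * h)) : ℝ) : ℂ) * Complex.I := by
    rw [Complex.ofReal_cos, Complex.ofReal_sin, ← Complex.exp_mul_I, e]
    push_cast; ring_nf
  rw [h1, cotFactor, Real.cos_two_mul, Real.sin_two_mul]
  have h2 := Real.sin_sq_add_cos_sq (Real.pi * h)
  generalize Real.sin (Real.pi * h) = s at *
  generalize Real.cos (Real.pi * h) = c at *
  have hs' : (s : ℂ) ≠ 0 := by exact_mod_cast hs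
  have h2' : (s : ℂ) ^ 2 + (c : ℂ) ^ 2 = 1 := by exact_mod_cast h2
  push_cast
  field_simp
  linear_combination (-2 * c * Complex.I) * h2' - 2 * s * c ^ 2 * Complex.I_sq

/-- With `σ = ± 1` this covers both `cotFactor x` and `1 - cotFactor x`. -/
lemma norm_half_add_cot {x : ℝ} (hs : 0 < Real.sin x) {σ : ℝ} (hσ : σ ^ 2 = 1) :
    ‖((1 / 2 : ℝ) : ℂ) + ((σ * (Real.cos x / (2 * Real.sin x)) : ℝ) : ℂ) * Complex.I‖
      = 1 / (2 * Real.sin x) := by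
  rw [Complex.norm_add_mul_I, Real.sqrt_eq_iff_mul_self_eq (by positivity) (by positivity)]
  have h2 := Real.sin_sq_add_cos_sq x
  field_simp
  linear_combination Real.cos x ^ 2 * hσ + h2

lemma norm_cotFactor {x : ℝ} (hs : 0 < Real.sin x) : ‖cotFactor x‖ = 1 / (2 * Real.sin x) := by
  simpa [cotFactor] using norm_half_add_cot hs (σ := 1) (by norm_num)

lemma norm_one_sub_cotFactor {x : ℝ} (hs : 0 < Real.sin x) :
    ‖1 - cotFactor x‖ = 1 / (2 * Real.sin x) := by
  rw [← norm_half_add_cot hs (σ := -1) (by norm_num), cotFactor]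
  congr 1
  push_cast; ring

lemma norm_cotFactor_sub (x y : ℝ) :
    ‖cotFactor y - cotFactor x‖
      = |Real.cos y / (2 * Real.sin y) - Real.cos x / (2 * Real.sin x)| := by
  have : cotFactor y - cotFactor x
      = ((Real.cos y / (2 * Real.sin y) - Real.cos x / (2 * Real.sin x) : ℝ) : ℂ) * Complex.I := by
    rw [cotFactor, cotFactor]; push_cast; ring
  rw [this, norm_mul, Complex.norm_I, mul_one, Complex.norm_real, Real.norm_eq_abs]

lemma half_cot_le {x y : ℝ} (hx : 0 < x) (hxy : x ≤ y) (hy : y < Real.pi) :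
    Real.cos y / (2 * Real.sin y) ≤ Real.cos x / (2 * Real.sin x) := by
  have h1 := Real.sin_pos_of_pos_of_lt_pi hx (by linarith)
  have h2 := Real.sin_pos_of_pos_of_lt_pi (by linarith) hy
  have h3 := Real.sin_nonneg_of_nonneg_of_le_pi (sub_nonneg.2 hxy) (by linarith)
  rw [Real.sin_sub] at h3
  rw [div_le_div_iff₀ (by positivity) (by positivity)]
  nlinarith

/-- The left-hand side is `cot (x / 2)`. -/
lemma one_add_cos_div_sin_le {x : ℝ} (hx : 0 < x) (hx' : x < Real.pi) :
    (1 + Real.cos x) / Real.sin x ≤ 2 / x := by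
  have h1 := Real.sin_pos_of_pos_of_lt_pi hx hx'
  rw [div_le_div_iff₀ h1 hx]
  obtain ⟨y, rfl⟩ : ∃ y, x = 2 * y := ⟨x / 2, by ring⟩
  have hc : 0 < Real.cos y := Real.cos_pos_of_mem_Ioo ⟨by linarith, by linarith⟩
  have ht := Real.le_tan (x := y) (by linarith) (by linarith)
  rw [Real.tan_eq_sin_div_cos, le_div_iff₀ hc] at ht
  rw [Real.cos_two_mul, Real.sin_two_mul]
  nlinarith [mul_le_mul_of_nonneg_right ht hc.le]

/-- **Kusmin–Landau inequality**: the increments of `a` are, modulo `1`, nondecreasing numbers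
`h n` that stay at distance at least `θ` from the integers. -/
lemma kusmin_landau {a h : ℕ → ℝ} {m : ℕ} {θ : ℝ} (hθ : 0 < θ) (hθ' : θ ≤ 1 / 2)
    (hh : ∀ n < m, θ ≤ h n ∧ h n ≤ 1 - θ)
    (hmono : ∀ n, n + 1 < m → h n ≤ h (n + 1))
    (ha : ∀ n < m, ∃ k : ℤ, a (n + 1) = a n + h n + k) :
    ‖∑ n ∈ Finset.range (m + 1), e (a n)‖ ≤ 2 / (Real.pi * θ) := by
  have hpi := Real.pi_pos
  have hlow : ∀ n < m, Real.pi * θ ≤ Real.pi * h n := fun n hn => by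
    have := (hh n hn).1; gcongr
  have hhigh : ∀ n < m, Real.pi * h n ≤ Real.pi - Real.pi * θ := fun n hn => by
    have := mul_le_mul_of_nonneg_left (hh n hn).2 hpi.le; linarith
  have hπθ : 0 < Real.pi * θ := by positivity
  have hsin : ∀ n < m, 0 < Real.sin (Real.pi * h n) := fun n hn =>
    Real.sin_pos_of_pos_of_lt_pi (hπθ.trans_le (hlow n hn)) (by linarith [hhigh n hn])
  have hz : ∀ n < m, e (a n) = cotFactor (Real.pi * h n) * (e (a n) - e (a (n + 1))) := by
    intro n hn
    obtain ⟨k, hk⟩ := ha n hn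
    rw [hk, e_add, e_add, e_intCast, mul_one]
    linear_combination (-e (a n)) * cotFactor_mul (hsin n hn).ne'
  rcases m with _ | m
  · simp only [zero_add, Finset.sum_range_one, norm_e]
    rw [le_div_iff₀ hπθ]
    nlinarith [Real.pi_le_four]
  -- partial summation, one term at a time
  have key : ∀ j, j < m + 1 →
      ‖∑ n ∈ Finset.range (j + 1), e (a n) + (cotFactor (Real.pi * h j) * e (a (j + 1)))‖
        ≤ 1 / (2 * Real.sin (Real.pi * h 0))
          + Real.cos (Real.pi * h 0) / (2 * Real.sin (Real.pi * h 0))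
          - Real.cos (Real.pi * h j) / (2 * Real.sin (Real.pi * h j)) := by
    intro j
    induction j with
    | zero =>
      intro hj
      have h1 : ∑ n ∈ Finset.range (0 + 1), e (a n) + cotFactor (Real.pi * h 0) * e (a (0 + 1))
          = cotFactor (Real.pi * h 0) * e (a 0) := by
        rw [zero_add, Finset.sum_range_one]
        linear_combination hz 0 hj
      rw [h1, norm_mul, norm_e, norm_cotFactor (hsin 0 hj)]
      linarith
    | succ j ih =>
      intro hj
      have h1 : ∑ n ∈ Finset.range (j + 1 + 1), e (a n)
            + cotFactor (Real.pi * h (j + 1)) * e (a (j + 1 + 1))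
          = (∑ n ∈ Finset.range (j + 1), e (a n) + cotFactor (Real.pi * h j) * e (a (j + 1)))
            + (cotFactor (Real.pi * h (j + 1)) - cotFactor (Real.pi * h j)) * e (a (j + 1)) := by
        rw [Finset.sum_range_succ]
        linear_combination hz (j + 1) hj
      have h2 : Real.cos (Real.pi * h (j + 1)) / (2 * Real.sin (Real.pi * h (j + 1)))
          ≤ Real.cos (Real.pi * h j) / (2 * Real.sin (Real.pi * h j)) := by
        refine half_cot_le (hπθ.trans_le (hlow j (by omega))) ?_ (by linarith [hhigh (j + 1) hj])
        have := hmono j hj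
        gcongr
      rw [h1]
      refine (norm_add_le _ _).trans ?_
      rw [norm_mul, norm_e, norm_cotFactor_sub, abs_of_nonpos (by linarith)]
      linarith [ih (by omega)]
  have h1 : ∑ n ∈ Finset.range (m + 1 + 1), e (a n)
      = (∑ n ∈ Finset.range (m + 1), e (a n) + cotFactor (Real.pi * h m) * e (a (m + 1)))
        + (1 - cotFactor (Real.pi * h m)) * e (a (m + 1)) := by
    rw [Finset.sum_range_succ]; ring
  have hm : m < m + 1 := m.lt_succ_self
  have h2 := one_add_cos_div_sin_le (hπθ.trans_le (hlow 0 (by omega)))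
    (by linarith [hhigh 0 (by omega)])
  have h3 := one_add_cos_div_sin_le (x := Real.pi - Real.pi * h m)
    (by linarith [hhigh m hm]) (by linarith [hlow m hm])
  rw [Real.cos_pi_sub, Real.sin_pi_sub] at h3
  have h4 : 2 / (Real.pi * h 0) ≤ 2 / (Real.pi * θ) := by
    have := hlow 0 (by omega); gcongr
  have h5 : 2 / (Real.pi - Real.pi * h m) ≤ 2 / (Real.pi * θ) := by
    have := hhigh m hm
    exact div_le_div_of_nonneg_left (by norm_num) hπθ (by linarith)
  rw [h1]
  refine (norm_add_le _ _).trans ?_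
  rw [norm_mul, norm_e, norm_one_sub_cotFactor (hsin m hm), mul_one]
  refine (add_le_add (key m hm) le_rfl).trans ?_
  have h6 : 1 / (2 * Real.sin (Real.pi * h 0))
      + Real.cos (Real.pi * h 0) / (2 * Real.sin (Real.pi * h 0))
      = (1 + Real.cos (Real.pi * h 0)) / Real.sin (Real.pi * h 0) / 2 := by
    have := (hsin 0 (by omega)).ne'
    field_simp
  have h7 : 1 / (2 * Real.sin (Real.pi * h m))
      - Real.cos (Real.pi * h m) / (2 * Real.sin (Real.pi * h m))
      = (1 + -Real.cos (Real.pi * h m)) / Real.sin (Real.pi * h m) / 2 := by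
    have := (hsin m hm).ne'
    field_simp
    ring
  linarith

/-! ### The second difference test -/

/-- The exponential sum `∑_{n < L} e(a n)`. -/
noncomputable def expSum (a : ℕ → ℝ) (L : ℕ) : ℂ := ∑ n ∈ Finset.range L, e (a n)

/-- The `k`-th forward differences of the finite sequence `a 0, …, a (L - 1)` lie in `[A, B]`. -/
def DiffBounds (k : ℕ) (A B : ℝ) (a : ℕ → ℝ) (L : ℕ) : Prop :=
  ∀ n, n + k < L → A ≤ (fwdDiff 1)^[k] a n ∧ (fwdDiff 1)^[k] a n ≤ B

lemma norm_expSum_le (a : ℕ → ℝ) (L : ℕ) : ‖expSum a L‖ ≤ L :=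
  (norm_sum_le _ _).trans (by simp [norm_e])

lemma mul_le_sub_of_gap {g : ℕ → ℝ} {A : ℝ} (hg : ∀ n, A ≤ g (n + 1) - g n) {x y : ℕ}
    (hxy : x ≤ y) : ((y : ℝ) - x) * A ≤ g y - g x := by
  induction y, hxy using Nat.le_induction with
  | base => simp
  | succ y _ ih => push_cast; linarith [hg y]

lemma sub_le_mul_of_gap {g : ℕ → ℝ} {B : ℝ} (hg : ∀ n, g (n + 1) - g n ≤ B) (n : ℕ) :
    g n - g 0 ≤ n * B := by
  induction n with
  | zero => simp
  | succ y ih => push_cast; linarith [hg y]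

lemma card_le_of_gap {g : ℕ → ℝ} {A D : ℝ} (hA : 0 < A) (hD : 0 ≤ D)
    (hg : ∀ n, A ≤ g (n + 1) - g n) (s : Finset ℕ)
    (hs : ∀ x ∈ s, ∀ y ∈ s, g y - g x ≤ D) : (s.card : ℝ) ≤ D / A + 1 := by
  rcases s.eq_empty_or_nonempty with rfl | hne
  · simp; positivity
  have hsub : s ⊆ Finset.Icc (s.min' hne) (s.max' hne) := fun x hx =>
    Finset.mem_Icc.2 ⟨s.min'_le x hx, s.le_max' x hx⟩
  have hle : s.min' hne ≤ s.max' hne := s.min'_le_max' hne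
  have h1 := Finset.card_le_card hsub
  rw [Nat.card_Icc] at h1
  have h2 : (s.card : ℝ) ≤ (s.max' hne : ℝ) + 1 - s.min' hne := by
    have : s.card + s.min' hne ≤ s.max' hne + 1 := by omega
    have : (s.card : ℝ) + s.min' hne ≤ s.max' hne + 1 := by exact_mod_cast this
    linarith
  have h3 := (mul_le_sub_of_gap hg hle).trans (hs _ (s.min'_mem hne) _ (s.max'_mem hne))
  have h4 := (le_div_iff₀ hA).2 h3
  linarith

lemma norm_sum_e_le_card (a : ℕ → ℝ) (s : Finset ℕ) : ‖∑ n ∈ s, e (a n)‖ ≤ s.card :=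
  (norm_sum_le _ _).trans (by simp [norm_e])

/-- The terms whose increment stays `Δ` away from the integers, on one unit interval. -/
lemma norm_sum_middle_le {a g : ℕ → ℝ} {L : ℕ} {A Δ : ℝ} (hA : 0 < A) (hΔ : 0 < Δ)
    (hg : ∀ n, A ≤ g (n + 1) - g n) (ha : ∀ n, n + 1 < L → a (n + 1) = a n + g n) (k : ℤ)
    (t : Finset ℕ) (ht : ∀ n, n ∈ t ↔ n < L ∧ k + Δ ≤ g n ∧ g n ≤ k + 1 - Δ) :
    ‖∑ n ∈ t, e (a n)‖ ≤ 2 / (Real.pi * Δ) := by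
  have hpi := Real.pi_pos
  rcases t.eq_empty_or_nonempty with rfl | hne
  · simp; positivity
  have hmono : Monotone g := monotone_nat_of_le_succ fun n => by linarith [hg n]
  have hp := (ht _).1 (t.min'_mem hne)
  have hq := (ht _).1 (t.max'_mem hne)
  have hle : t.min' hne ≤ t.max' hne := t.min'_le_max' hne
  have heq : t = Finset.Ico (t.min' hne) (t.max' hne + 1) := by
    ext x
    rw [Finset.mem_Ico]
    refine ⟨fun hx => ⟨t.min'_le x hx, Nat.lt_succ_of_le (t.le_max' x hx)⟩, fun hx => ?_⟩
    have hx2 : x ≤ t.max' hne := Nat.le_of_lt_succ hx.2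
    exact (ht x).2 ⟨by omega, hp.2.1.trans (hmono hx.1), (hmono hx2).trans hq.2.2⟩
  generalize t.min' hne = p at *
  generalize t.max' hne = q at *
  rw [heq, Finset.sum_Ico_eq_sum_range, Nat.sub_add_comm hle]
  refine kusmin_landau (h := fun n => g (p + n) - k) hΔ (by linarith) ?_ ?_ ?_
  · intro n hn
    have h1 := hmono (show p ≤ p + n by omega)
    have h2 := hmono (show p + n ≤ q by omega)
    constructor <;> linarith
  · intro n _
    have := hmono (show p + n ≤ p + (n + 1) by omega)
    simpa using this
  · intro n hn
    exact ⟨k, by rw [← add_assoc, ha (p + n) (by omega)]; ring⟩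

/-- The terms whose increment lies in one unit interval `[k, k + 1)`. -/
lemma norm_sum_block_le {a g : ℕ → ℝ} {L : ℕ} {A Δ : ℝ} (hA : 0 < A) (hΔ : 0 < Δ)
    (hg : ∀ n, A ≤ g (n + 1) - g n) (ha : ∀ n, n + 1 < L → a (n + 1) = a n + g n) (k : ℤ) :
    ‖∑ n ∈ Finset.range L with ⌊g n⌋ = k, e (a n)‖ ≤ 2 * (Δ / A + 1) + 2 / (Real.pi * Δ) := by
  have hfl : ∀ n, ⌊g n⌋ = k → (k : ℝ) ≤ g n ∧ g n < k + 1 := fun n hn => Int.floor_eq_iff.1 hn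
  rw [← Finset.sum_filter_add_sum_filter_not _ (fun n => k + Δ ≤ g n),
    ← Finset.sum_filter_add_sum_filter_not
      (((Finset.range L).filter (fun n => ⌊g n⌋ = k)).filter (fun n => k + Δ ≤ g n))
      (fun n => g n ≤ k + 1 - Δ)]
  refine (norm_add_le _ _).trans ?_
  refine (add_le_add (norm_add_le _ _) le_rfl).trans ?_
  have h1 := norm_sum_middle_le hA hΔ hg ha k
    ((((Finset.range L).filter (fun n => ⌊g n⌋ = k)).filter (fun n => k + Δ ≤ g n)).filter
      (fun n => g n ≤ k + 1 - Δ)) (by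
      intro n
      simp only [Finset.mem_filter, Finset.mem_range]
      refine ⟨fun h => ⟨h.1.1.1, h.1.2, h.2⟩, fun h => ⟨⟨⟨h.1, ?_⟩, h.2.1⟩, h.2.2⟩⟩
      exact Int.floor_eq_iff.2 ⟨by linarith [h.2.1], by linarith [h.2.2]⟩)
  have h2 := (norm_sum_e_le_card a _).trans (card_le_of_gap hA hΔ.le hg
    ((((Finset.range L).filter (fun n => ⌊g n⌋ = k)).filter (fun n => k + Δ ≤ g n)).filter
      (fun n => ¬ g n ≤ k + 1 - Δ)) (by
      intro x hx y hy
      simp only [Finset.mem_filter, Finset.mem_range, not_le] at hx hy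
      linarith [(hfl y hy.1.1.2).2]))
  have h3 := (norm_sum_e_le_card a _).trans (card_le_of_gap hA hΔ.le hg
    (((Finset.range L).filter (fun n => ⌊g n⌋ = k)).filter (fun n => ¬ k + Δ ≤ g n)) (by
      intro x hx y hy
      simp only [Finset.mem_filter, Finset.mem_range, not_le] at hx hy
      linarith [(hfl x hx.1.2).1]))
  linarith

/-- The second difference test for a sequence given by its increments `g`, which are prescribed
beyond the range of summation as well. -/
lemma norm_expSum_le_of_increments {a g : ℕ → ℝ} {L : ℕ} {A B : ℝ} (hA : 0 < A)
    (hg : ∀ n, A ≤ g (n + 1) - g n) (hg' : ∀ n, g (n + 1) - g n ≤ B)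
    (ha : ∀ n, n + 1 < L → a (n + 1) = a n + g n) :
    ‖expSum a L‖ ≤ (B * L + 2) * (4 / √(Real.pi * A) + 2) := by
  have hpi := Real.pi_pos
  have hB : 0 ≤ B := hA.le.trans ((hg 0).trans (hg' 0))
  have hmono : Monotone g := monotone_nat_of_le_succ fun n => by linarith [hg n]
  have hs : 0 < √(Real.pi * A) := by positivity
  have hss : √(Real.pi * A) ^ 2 = Real.pi * A := Real.sq_sqrt (by positivity)
  have hΔ : 0 < √(Real.pi * A) / Real.pi := by positivity
  -- the choice `Δ = √(π A) / π` balances `2 Δ / A` against `2 / (π Δ)`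
  have hval : 2 * (√(Real.pi * A) / Real.pi / A + 1)
      + 2 / (Real.pi * (√(Real.pi * A) / Real.pi)) = 4 / √(Real.pi * A) + 2 := by
    field_simp
    linear_combination 2 * hss
  rcases L with _ | L
  · simp only [expSum, Finset.range_zero, Finset.sum_empty, norm_zero]
    positivity
  have hmaps : ∀ n ∈ Finset.range (L + 1), ⌊g n⌋ ∈ Finset.Icc ⌊g 0⌋ ⌊g L⌋ := fun n hn =>
    Finset.mem_Icc.2 ⟨Int.floor_le_floor (hmono n.zero_le),
      Int.floor_le_floor (hmono (Nat.le_of_lt_succ (Finset.mem_range.1 hn)))⟩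
  -- `g` runs through `L` steps between its `L + 1` values, so it meets at most `B L + 2` intervals
  have hcard : ((Finset.Icc ⌊g 0⌋ ⌊g L⌋).card : ℝ) ≤ B * (L + 1 : ℕ) + 2 := by
    rw [Int.card_Icc]
    have h0 : ⌊g 0⌋ ≤ ⌊g L⌋ := Int.floor_le_floor (hmono L.zero_le)
    have h1 : (((⌊g L⌋ + 1 - ⌊g 0⌋).toNat : ℤ) : ℝ) = (⌊g L⌋ : ℝ) + 1 - ⌊g 0⌋ := by
      rw [Int.toNat_of_nonneg (by omega)]; push_cast; ring
    rw [Int.cast_natCast] at h1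
    rw [h1]
    push_cast
    have := sub_le_mul_of_gap hg' L
    linarith [Int.floor_le (g L), Int.lt_floor_add_one (g 0)]
  rw [expSum, ← Finset.sum_fiberwise_of_maps_to hmaps]
  refine (norm_sum_le _ _).trans ?_
  refine (Finset.sum_le_sum fun k _ =>
    (norm_sum_block_le hA hΔ hg ha k).trans hval.le).trans ?_
  rw [Finset.sum_const, nsmul_eq_mul]
  gcongr

/-- **Second difference test.** -/
lemma second_difference_test {a : ℕ → ℝ} {L : ℕ} {A B : ℝ} (hA : 0 < A) (hAB : A ≤ B)
    (h : DiffBounds 2 A B a L) : ‖expSum a L‖ ≤ (B * L + 2) * (4 / √(Real.pi * A) + 2) := by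
  have h' : ∀ n, n + 2 < L →
      A ≤ (a (n + 2) - a (n + 1)) - (a (n + 1) - a n) ∧
        (a (n + 2) - a (n + 1)) - (a (n + 1) - a n) ≤ B := fun n hn => by
    simpa [fwdDiff] using h n hn
  -- beyond the range of `a`, the increments are continued with slope `A`
  refine norm_expSum_le_of_increments (g := fun n => if n + 1 < L then a (n + 1) - a n
    else a (L - 2 + 1) - a (L - 2) + ((n : ℝ) - (L - 2 : ℕ)) * A) hA ?_ ?_ ?_
  · intro n
    rcases lt_trichotomy (n + 2) L with hn | hn | hn
    · simpa [show n + 1 < L by omega, show n + 1 + 1 < L by omega] using (h' n hn).1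
    · subst hn
      simp
    · simp only [show ¬ n + 1 + 1 < L by omega, show ¬ n + 1 < L by omega, if_false]
      push_cast
      linarith
  · intro n
    rcases lt_trichotomy (n + 2) L with hn | hn | hn
    · simpa [show n + 1 < L by omega, show n + 1 + 1 < L by omega] using (h' n hn).2
    · subst hn
      simpa using hAB
    · simp only [show ¬ n + 1 + 1 < L by omega, show ¬ n + 1 < L by omega, if_false]
      push_cast
      linarith
  · intro n hn
    simp [hn]

/-! ### Sums of powers with triangular weights -/

/-- The trapezoidal rule underestimates the integral of a concave function. -/
lemma trapezoid_le_integral {f : ℝ → ℝ} {a : ℝ} (hf : ConcaveOn ℝ (Set.Icc a (a + 1)) f)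
    (hc : ContinuousOn f (Set.Icc a (a + 1))) :
    (f a + f (a + 1)) / 2 ≤ ∫ x in a..(a + 1), f x := by
  have h1 : ∫ x in a..(a + 1), ((a + 1 - x) * f a + (x - a) * f (a + 1))
      = (f a + f (a + 1)) / 2 := by
    have e1 : ∀ x : ℝ, (a + 1 - x) * f a + (x - a) * f (a + 1)
        = ((a + 1) * f a - a * f (a + 1)) + (f (a + 1) - f a) * x := fun x => by ring
    simp_rw [e1]
    rw [intervalIntegral.integral_add (by simp) (by
        apply Continuous.intervalIntegrable; fun_prop),
      intervalIntegral.integral_const, intervalIntegral.integral_const_mul, integral_id]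
    simp only [smul_eq_mul]
    ring
  rw [← h1]
  refine intervalIntegral.integral_mono_on (by linarith)
    (by apply Continuous.intervalIntegrable; fun_prop)
    (ContinuousOn.intervalIntegrable (by rwa [Set.uIcc_of_le (by linarith)])) fun x hx => ?_
  have := hf.2 (Set.left_mem_Icc.2 (by linarith)) (Set.right_mem_Icc.2 (by linarith))
    (show 0 ≤ a + 1 - x by linarith [hx.2]) (show 0 ≤ x - a by linarith [hx.1]) (by ring)
  simp only [smul_eq_mul] at this
  rwa [show (a + 1 - x) * a + (x - a) * (a + 1) = x by ring] at this

/-- The summand is a concave function of `h` that vanishes at `M`, so the sum is at most its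
integral by the trapezoidal rule. -/
lemma sum_weight_mul_rpow_le_of_nonneg {p : ℝ} (hp0 : 0 ≤ p) (hp1 : p ≤ 1) (M : ℕ) :
    ∑ h ∈ Finset.Ico 1 M, ((M : ℝ) - h) * (h : ℝ) ^ p
      ≤ (M : ℝ) ^ (p + 2) / ((p + 1) * (p + 2)) := by
  set f : ℝ → ℝ := fun x => M * x ^ p - x ^ (p + 1) with hfdef
  have hcont : Continuous f := by
    have h1 := Real.continuous_rpow_const (q := p) hp0
    have h2 := Real.continuous_rpow_const (q := p + 1) (by linarith)
    fun_prop
  have hconc : ConcaveOn ℝ (Set.Ici 0) f :=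
    ((Real.concaveOn_rpow hp0 hp1).smul (Nat.cast_nonneg M)).sub
      (convexOn_rpow (by linarith))
  have hfM : f M = 0 := by
    rcases M.eq_zero_or_pos with rfl | hM
    · simp [hfdef, Real.zero_rpow (show p + 1 ≠ 0 by linarith)]
    · have : (0 : ℝ) < M := by exact_mod_cast hM
      simp only [hfdef]
      rw [Real.rpow_add this, Real.rpow_one]; ring
  have hf0 : 0 ≤ f 0 := by
    simp only [hfdef, Real.zero_rpow (show p + 1 ≠ 0 by linarith), sub_zero]
    positivity
  have hterm : ∀ h ∈ Finset.Ico 1 M, ((M : ℝ) - h) * (h : ℝ) ^ p = f h := fun h hh => by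
    have : (0 : ℝ) < h := by exact_mod_cast (Finset.mem_Ico.1 hh).1
    simp only [hfdef]
    rw [Real.rpow_add this, Real.rpow_one]; ring
  have hint : ∫ x in (0 : ℝ)..M, f x = (M : ℝ) ^ (p + 2) / ((p + 1) * (p + 2)) := by
    simp only [hfdef]
    rw [intervalIntegral.integral_sub
        ((intervalIntegral.intervalIntegrable_rpow' (by linarith)).const_mul _)
        (intervalIntegral.intervalIntegrable_rpow' (by linarith)),
      intervalIntegral.integral_const_mul, integral_rpow (Or.inl (by linarith)),
      integral_rpow (Or.inl (by linarith)), Real.zero_rpow (by linarith),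
      Real.zero_rpow (by linarith), show p + 1 + 1 = p + 2 by ring]
    have h1 : p + 1 ≠ 0 := by linarith
    have h2 : p + 2 ≠ 0 := by linarith
    have h3 : (M : ℝ) ^ (p + 2) = (M : ℝ) ^ (p + 1) * M := by
      rw [← Real.rpow_add_one' (Nat.cast_nonneg M) (by linarith)]; ring_nf
    rw [h3]
    field_simp
    ring
  rw [Finset.sum_congr rfl hterm, ← hint]
  have hsum := intervalIntegral.sum_integral_adjacent_intervals (f := f)
    (a := fun n : ℕ => (n : ℝ)) (n := M) (μ := MeasureTheory.volume)
    fun k _ => hcont.intervalIntegrable _ _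
  simp only [Nat.cast_zero] at hsum
  rw [← hsum]
  have htrap : ∑ k ∈ Finset.range M, (f k + f (k + 1 : ℕ)) / 2
      ≤ ∑ k ∈ Finset.range M, ∫ x in (k : ℝ)..(k + 1 : ℕ), f x := by
    refine Finset.sum_le_sum fun k _ => ?_
    have hk : (0 : ℝ) ≤ k := Nat.cast_nonneg k
    have := trapezoid_le_integral (f := f) (a := k)
      (hconc.subset (fun x hx => hk.trans hx.1) (convex_Icc _ _)) hcont.continuousOn
    push_cast
    exact this
  refine le_trans ?_ htrap
  rw [← Finset.sum_div, Finset.sum_add_distrib]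
  rcases M with _ | M
  · simp
  have e1 : ∑ k ∈ Finset.range (M + 1), f k = f 0 + ∑ h ∈ Finset.Ico 1 (M + 1), f h := by
    rw [Finset.range_eq_Ico, Finset.sum_eq_sum_Ico_succ_bot (by omega)]; simp
  have e2 : ∑ k ∈ Finset.range (M + 1), f (k + 1 : ℕ)
      = ∑ h ∈ Finset.Ico 1 (M + 1), f h + f (M + 1 : ℕ) := by
    rw [Finset.sum_range_succ, Finset.sum_Ico_eq_sum_range]
    simp [add_comm]
  rw [e1, e2, hfM]
  linarith

lemma rpow_le_sub_rpow {q : ℝ} (hq0 : 0 < q) (hq1 : q ≤ 1) {h : ℕ} (hh : 1 ≤ h) :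
    (h : ℝ) ^ (q - 1) ≤ ((h : ℝ) ^ q - ((h : ℝ) - 1) ^ q) / q := by
  have h0 : (1 : ℝ) ≤ h := by exact_mod_cast hh
  have hpos : (0 : ℝ) < h := by linarith
  have hinv : (h : ℝ)⁻¹ ≤ 1 := inv_le_one_of_one_le₀ h0
  have h1 := rpow_one_add_le_one_add_mul_self (s := -(h : ℝ)⁻¹) (by linarith) hq0.le hq1
  have h2 : ((h : ℝ) - 1) ^ q = (h : ℝ) ^ q * (1 + -(h : ℝ)⁻¹) ^ q := by
    rw [← Real.mul_rpow hpos.le (by linarith)]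
    congr 1
    field_simp
    ring
  rw [le_div_iff₀ hq0, h2, Real.rpow_sub_one hpos.ne']
  have h3 := mul_le_mul_of_nonneg_left h1 (Real.rpow_nonneg hpos.le q)
  have h4 : (h : ℝ) ^ q / h * q = (h : ℝ) ^ q * (q * (h : ℝ)⁻¹) := by ring
  rw [h4]
  linarith

lemma mul_rpow_le_sub_rpow {q : ℝ} (hq1 : 1 ≤ q) {j : ℕ} (hj : 1 ≤ j) :
    q * (j : ℝ) ^ (q - 1) ≤ ((j : ℝ) + 1) ^ q - (j : ℝ) ^ q := by
  have h0 : (1 : ℝ) ≤ j := by exact_mod_cast hj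
  have hpos : (0 : ℝ) < j := by linarith
  have h1 := one_add_mul_self_le_rpow_one_add (s := (j : ℝ)⁻¹)
    (by linarith [inv_pos.2 hpos]) hq1
  have h2 : ((j : ℝ) + 1) ^ q = (j : ℝ) ^ q * (1 + (j : ℝ)⁻¹) ^ q := by
    rw [← Real.mul_rpow hpos.le (by positivity)]
    congr 1
    field_simp
  rw [h2, Real.rpow_sub_one hpos.ne']
  have h3 := mul_le_mul_of_nonneg_left h1 (Real.rpow_nonneg hpos.le q)
  have h4 : q * ((j : ℝ) ^ q / j) = (j : ℝ) ^ q * (q * (j : ℝ)⁻¹) := by ring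
  rw [h4]
  linarith

lemma sum_rpow_le {p : ℝ} (hp : -1 < p) (hp0 : p ≤ 0) (M : ℕ) :
    ∑ h ∈ Finset.Ico 1 (M + 1), (h : ℝ) ^ p ≤ (M : ℝ) ^ (p + 1) / (p + 1) := by
  induction M with
  | zero => simp [Real.zero_rpow (show p + 1 ≠ 0 by linarith)]
  | succ M ih =>
    rw [Finset.sum_Ico_succ_top (by omega)]
    have := rpow_le_sub_rpow (q := p + 1) (by linarith) (by linarith) (show 1 ≤ M + 1 by omega)
    rw [add_sub_cancel_right, sub_div] at this
    push_cast at *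
    rw [add_sub_cancel_right] at this
    linarith

/-- The integral comparison is done by telescoping, both inequalities being instances of
Bernoulli's: for negative `p` the junk value `0 ^ p = 0` makes `x ^ p` fail to be antitone
on `[0, M]`. -/
lemma sum_weight_mul_rpow_le_of_nonpos {p : ℝ} (hp : -1 < p) (hp0 : p ≤ 0) (M : ℕ) :
    ∑ h ∈ Finset.Ico 1 M, ((M : ℝ) - h) * (h : ℝ) ^ p
      ≤ (M : ℝ) ^ (p + 2) / ((p + 1) * (p + 2)) := by
  induction M with
  | zero => simp [Real.zero_rpow (show p + 2 ≠ 0 by linarith)]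
  | succ M ih =>
    have hp1 : 0 < p + 1 := by linarith
    have hp2 : 0 < p + 2 := by linarith
    -- raising the weight by one adds an unweighted power sum
    have h1 : ∑ h ∈ Finset.Ico 1 (M + 1), (((M + 1 : ℕ) : ℝ) - h) * (h : ℝ) ^ p
        = ∑ h ∈ Finset.Ico 1 M, ((M : ℝ) - h) * (h : ℝ) ^ p
          + ∑ h ∈ Finset.Ico 1 (M + 1), (h : ℝ) ^ p := by
      rcases M with _ | M
      · simp
      rw [Finset.sum_Ico_succ_top (by omega), Finset.sum_Ico_succ_top (b := M + 1) (by omega),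
        ← add_assoc, ← Finset.sum_add_distrib]
      push_cast
      congr 1
      · exact Finset.sum_congr rfl fun h _ => by ring
      · ring
    rw [h1]
    refine (add_le_add ih (sum_rpow_le hp hp0 M)).trans ?_
    rcases M with _ | M
    · simp [Real.zero_rpow hp1.ne', Real.zero_rpow hp2.ne']
      positivity
    have h2 := mul_rpow_le_sub_rpow (q := p + 2) (by linarith) (show 1 ≤ M + 1 by omega)
    rw [show p + 2 - 1 = p + 1 by ring] at h2
    have h3 : ((M + 1 : ℕ) : ℝ) ^ (p + 1) / (p + 1)
        = (p + 2) * ((M + 1 : ℕ) : ℝ) ^ (p + 1) / ((p + 1) * (p + 2)) := by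
      field_simp
    rw [h3, ← add_div]
    rw [Nat.cast_add_one (M + 1)]
    gcongr
    linarith

lemma sum_weight_mul_rpow_le {p : ℝ} (hp : -1 < p) (hp1 : p ≤ 1) (M : ℕ) :
    ∑ h ∈ Finset.Ico 1 M, ((M : ℝ) - h) * (h : ℝ) ^ p
      ≤ (M : ℝ) ^ (p + 2) / ((p + 1) * (p + 2)) := by
  rcases le_total 0 p with h | h
  · exact sum_weight_mul_rpow_le_of_nonneg h hp1 M
  · exact sum_weight_mul_rpow_le_of_nonpos hp h M

/-! ### The Weyl–van der Corput inequality -/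

/-- Counting the pairs of indices below `M` by their distance. -/
lemma sum_sum_dist (F : ℕ → ℝ) (M : ℕ) :
    ∑ i ∈ Finset.range M, ∑ j ∈ Finset.range M, F (Nat.dist i j)
      = M * F 0 + 2 * ∑ h ∈ Finset.Ico 1 M, ((M : ℝ) - h) * F h := by
  induction M with
  | zero => simp
  | succ M ih =>
    have hrow : ∑ j ∈ Finset.range M, F (Nat.dist M j) = ∑ h ∈ Finset.Ico 1 (M + 1), F h := by
      rw [← Finset.sum_range_reflect, Finset.sum_Ico_eq_sum_range, Nat.add_sub_cancel]
      refine Finset.sum_congr rfl fun j hj => ?_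
      have := Finset.mem_range.1 hj
      rw [Nat.dist_eq_sub_of_le_right (by omega)]
      congr 1
      omega
    have h1 : ∑ i ∈ Finset.range (M + 1), ∑ j ∈ Finset.range (M + 1), F (Nat.dist i j)
        = ∑ i ∈ Finset.range M, ∑ j ∈ Finset.range M, F (Nat.dist i j)
          + (F 0 + 2 * ∑ h ∈ Finset.Ico 1 (M + 1), F h) := by
      simp only [Finset.sum_range_succ, Finset.sum_add_distrib, Nat.dist_self]
      simp_rw [Nat.dist_comm _ M, hrow]
      ring
    have h2 : ∑ h ∈ Finset.Ico 1 (M + 1), (((M + 1 : ℕ) : ℝ) - h) * F h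
        = ∑ h ∈ Finset.Ico 1 M, ((M : ℝ) - h) * F h + ∑ h ∈ Finset.Ico 1 (M + 1), F h := by
      rcases M with _ | M
      · simp
      rw [Finset.sum_Ico_succ_top (by omega), Finset.sum_Ico_succ_top (b := M + 1) (by omega),
        ← add_assoc, ← Finset.sum_add_distrib]
      push_cast
      congr 1
      · exact Finset.sum_congr rfl fun h _ => by ring
      · ring
    rw [h1, h2, ih]
    push_cast
    ring

/-- The window `[0, L + M - 1)` contains every shift by `m < M` of the support `[0, L)`. -/
lemma sum_shift_eq {F : ℤ → ℂ} {L M m : ℕ} (hF : ∀ n, n < 0 ∨ (L : ℤ) ≤ n → F n = 0)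
    (hm : m < M) :
    ∑ k ∈ Finset.Ico (0 : ℤ) (L + M - 1), F (k - m) = ∑ n ∈ Finset.range L, F n := by
  symm
  refine Finset.sum_of_injOn (fun n : ℕ => (n : ℤ) + m) ?_ ?_ ?_ ?_
  · intro x _ y _ hxy
    simpa using hxy
  · intro n hn
    have := Finset.mem_range.1 (Finset.mem_coe.1 hn)
    simp only [Finset.coe_Ico, Set.mem_Ico]
    omega
  · intro k _ hk
    apply hF
    by_contra! hcon
    refine hk ⟨(k - m).toNat, ?_, ?_⟩
    · simp only [Finset.coe_range, Set.mem_Iio]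
      omega
    · simp only
      omega
  · intro n _
    simp

/-- The sequence `e(a 0), …, e(a (L - 1))`, extended by zero to the integers. -/
noncomputable def zeroExtend (a : ℕ → ℝ) (L : ℕ) (n : ℤ) : ℂ :=
  if 0 ≤ n ∧ n < L then e (a n.toNat) else 0

lemma zeroExtend_of_notMem (a : ℕ → ℝ) (L : ℕ) {n : ℤ} (hn : n < 0 ∨ (L : ℤ) ≤ n) :
    zeroExtend a L n = 0 := if_neg (by omega)

lemma zeroExtend_natCast (a : ℕ → ℝ) {L n : ℕ} (hn : n < L) :
    zeroExtend a L n = e (a n) := by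
  rw [zeroExtend, if_pos (by omega)]; simp

lemma sum_correlation (a : ℕ → ℝ) (L h : ℕ) :
    ∑ n ∈ Finset.range L, zeroExtend a L (n + h) * (starRingEnd ℂ) (zeroExtend a L n)
      = expSum (fun n => a (n + h) - a n) (L - h) := by
  rw [expSum, ← Finset.sum_subset (Finset.range_mono (Nat.sub_le L h))]
  · refine Finset.sum_congr rfl fun n hn => ?_
    have := Finset.mem_range.1 hn
    rw [← Nat.cast_add, zeroExtend_natCast a (by omega), zeroExtend_natCast a (by omega), e_sub]
  · intro n _ hn
    rw [Finset.mem_range] at hn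
    rw [zeroExtend_of_notMem a L (Or.inr (by omega)), zero_mul]

lemma norm_sum_shift_mul_conj (a : ℕ → ℝ) {L M i j : ℕ} (hi : i < M) (hj : j < M) :
    ‖∑ k ∈ Finset.Ico (0 : ℤ) (L + M - 1),
        zeroExtend a L (k - i) * (starRingEnd ℂ) (zeroExtend a L (k - j))‖
      = ‖expSum (fun n => a (n + Nat.dist i j) - a n) (L - Nat.dist i j)‖ := by
  wlog hij : i ≤ j generalizing i j
  · rw [Nat.dist_comm, ← this hj hi (by omega), ← Complex.norm_conj, map_sum]
    simp only [map_mul, Complex.conj_conj, mul_comm]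
  rw [Nat.dist_eq_sub_of_le hij, ← sum_correlation,
    ← sum_shift_eq (F := fun n => zeroExtend a L (n + (j - i : ℕ))
      * (starRingEnd ℂ) (zeroExtend a L n)) (M := M) (m := j) ?_ hj]
  · congr 1
    refine Finset.sum_congr rfl fun k _ => ?_
    rw [Nat.cast_sub hij]
    congr 2
    ring
  · intro n hn
    rw [zeroExtend_of_notMem a L hn, map_zero, mul_zero]

/-- **Weyl–van der Corput inequality.** -/
lemma weyl_van_der_corput (a : ℕ → ℝ) (L : ℕ) {M : ℕ} (hM : 1 ≤ M) :
    (M : ℝ) ^ 2 * ‖expSum a L‖ ^ 2 ≤ ((L : ℝ) + M - 1) *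
      (M * L + 2 * ∑ h ∈ Finset.Ico 1 M,
        ((M : ℝ) - h) * ‖expSum (fun n => a (n + h) - a n) (L - h)‖) := by
  set z := zeroExtend a L with hz
  set K := Finset.Ico (0 : ℤ) (L + M - 1) with hK
  have hcard : ((K.card : ℕ) : ℝ) = (L : ℝ) + M - 1 := by
    have h1 : ((K.card : ℕ) : ℤ) = L + M - 1 := by
      rw [hK, Int.card_Ico, Int.toNat_of_nonneg (by omega)]; ring
    exact_mod_cast congrArg (Int.cast : ℤ → ℝ) h1
  have hS : (M : ℂ) * expSum a L = ∑ k ∈ K, ∑ m ∈ Finset.range M, z (k - m) := by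
    rw [Finset.sum_comm, Finset.sum_congr rfl fun m hm =>
      sum_shift_eq (fun n => zeroExtend_of_notMem a L) (Finset.mem_range.1 hm)]
    rw [Finset.sum_const, Finset.card_range, nsmul_eq_mul, expSum]
    congr 1
    exact Finset.sum_congr rfl fun n hn => (zeroExtend_natCast a (Finset.mem_range.1 hn)).symm
  have hsq : ∑ k ∈ K, ‖∑ m ∈ Finset.range M, z (k - m)‖ ^ 2
      ≤ ∑ i ∈ Finset.range M, ∑ j ∈ Finset.range M,
        ‖expSum (fun n => a (n + Nat.dist i j) - a n) (L - Nat.dist i j)‖ := by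
    have h1 : ((∑ k ∈ K, ‖∑ m ∈ Finset.range M, z (k - m)‖ ^ 2 : ℝ) : ℂ)
        = ∑ i ∈ Finset.range M, ∑ j ∈ Finset.range M,
          ∑ k ∈ K, z (k - i) * (starRingEnd ℂ) (z (k - j)) := by
      rw [Finset.sum_congr rfl fun i _ => Finset.sum_comm, Finset.sum_comm]
      push_cast
      refine Finset.sum_congr rfl fun k _ => ?_
      rw [← Complex.mul_conj', map_sum, Finset.sum_mul_sum]
    have h2 : ∑ k ∈ K, ‖∑ m ∈ Finset.range M, z (k - m)‖ ^ 2
        = ‖((∑ k ∈ K, ‖∑ m ∈ Finset.range M, z (k - m)‖ ^ 2 : ℝ) : ℂ)‖ := by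
      rw [Complex.norm_real, Real.norm_of_nonneg (Finset.sum_nonneg fun _ _ => sq_nonneg _)]
    rw [h2, h1]
    refine norm_sum_le_of_le _ fun i hi => norm_sum_le_of_le _ fun j hj => ?_
    exact (norm_sum_shift_mul_conj a (Finset.mem_range.1 hi) (Finset.mem_range.1 hj)).le
  have hcs : ((M : ℝ) * ‖expSum a L‖) ^ 2
      ≤ K.card * ∑ k ∈ K, ‖∑ m ∈ Finset.range M, z (k - m)‖ ^ 2 := by
    refine le_trans ?_ sq_sum_le_card_mul_sum_sq
    have h1 : (M : ℝ) * ‖expSum a L‖ = ‖(M : ℂ) * expSum a L‖ := by simp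
    rw [h1, hS]
    gcongr
    exact norm_sum_le _ _
  have hcard0 : 0 ≤ (L : ℝ) + M - 1 := hcard ▸ Nat.cast_nonneg _
  rw [mul_pow, hcard] at hcs
  refine hcs.trans (mul_le_mul_of_nonneg_left (hsq.trans ?_) hcard0)
  rw [sum_sum_dist (fun h => ‖expSum (fun n => a (n + h) - a n) (L - h)‖) M]
  gcongr
  exact norm_expSum_le _ _

/-! ### The differencing step -/

/-- Differencing with shift `m` lowers the order of the controlled difference by one and multiplies
its bounds by `m`. -/
lemma DiffBounds.shift_sub {k : ℕ} {A B : ℝ} {a : ℕ → ℝ} {L : ℕ}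
    (h : DiffBounds (k + 1) A B a L) (m : ℕ) :
    DiffBounds k (m * A) (m * B) (fun n => a (n + m) - a n) (L - m) := by
  intro n hn
  have h1 : (fwdDiff 1)^[k] (fun n => a (n + m) - a n) n
      = ∑ j ∈ Finset.range m, (fwdDiff 1)^[k + 1] a (n + j) := by
    have h2 : (fun n => a (n + m) - a n) = (fun n => a (n + m)) + (-1 : ℝ) • a := by
      ext n; simp; ring
    rw [h2, fwdDiff_iter_add, fwdDiff_iter_const_smul]
    simp only [Pi.add_apply, Pi.smul_apply, fwdDiff_iter_comp_add, Function.iterate_succ_apply']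
    have h3 := Finset.sum_range_sub (fun j => (fwdDiff 1)^[k] a (n + j)) m
    simp only [add_zero] at h3
    simp only [fwdDiff, ← add_assoc] at h3 ⊢
    rw [h3, smul_eq_mul]
    ring
  have h4 : ∀ j ∈ Finset.range m, n + j + (k + 1) < L := fun j hj => by
    have := Finset.mem_range.1 hj; omega
  rw [h1]
  constructor
  · simpa using Finset.card_nsmul_le_sum _ _ _ fun j hj => (h _ (h4 j hj)).1
  · simpa using Finset.sum_le_card_nsmul _ _ _ fun j hj => (h _ (h4 j hj)).2

/-- The Weyl–van der Corput inequality with `⌈η W ^ κ⌉` shifts, when the differenced sums with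
shift `m` are bounded by a combination of powers of `m`. The numbers `R i` absorb the rounding
in the `p i`-th power of the number of shifts. -/
lemma differencing_step {ι : Type*} [Fintype ι] {a : ℕ → ℝ} {L : ℕ} {W κ η : ℝ} (hW : 0 < W)
    (hη : 0 < η) (c s p R : ι → ℝ) (hc : ∀ i, 0 ≤ c i) (hp : ∀ i, -1 < p i) (hp1 : ∀ i, p i ≤ 1)
    (hR : ∀ i, (p i ≤ 0 ∧ η ^ p i ≤ R i) ∨ (0 ≤ p i ∧ (η + W ^ (-κ)) ^ p i ≤ R i))
    (h : ∀ m : ℕ, 1 ≤ m → ‖expSum (fun n => a (n + m) - a n) (L - m)‖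
      ≤ ∑ i, c i * W ^ s i * (m : ℝ) ^ p i) :
    ‖expSum a L‖ ^ 2 ≤ (L * W ^ (-κ) + η) *
      (L / η + ∑ i, 2 / ((p i + 1) * (p i + 2)) * c i * R i * W ^ (κ + s i + κ * p i)) := by
  have hY : 0 < W ^ κ := Real.rpow_pos_of_pos hW κ
  have hYinv : W ^ (-κ) * W ^ κ = 1 := by rw [← Real.rpow_add hW]; simp
  have hηY : 0 < η * W ^ κ := by positivity
  set M := ⌈η * W ^ κ⌉₊ with hMdef
  have hM1 : 1 ≤ M := Nat.one_le_iff_ne_zero.2 (Nat.ceil_pos.2 hηY).ne'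
  have hMlow : η * W ^ κ ≤ M := Nat.le_ceil _
  have hMhigh : (M : ℝ) < η * W ^ κ + 1 := Nat.ceil_lt_add_one hηY.le
  have hM0 : (0 : ℝ) < M := by exact_mod_cast hM1
  have hsum : ∑ m ∈ Finset.Ico 1 M, ((M : ℝ) - m) * ‖expSum (fun n => a (n + m) - a n) (L - m)‖
      ≤ ∑ i, c i * W ^ s i * ((M : ℝ) ^ (p i + 2) / ((p i + 1) * (p i + 2))) := by
    calc _ ≤ ∑ m ∈ Finset.Ico 1 M, ((M : ℝ) - m) * ∑ i, c i * W ^ s i * (m : ℝ) ^ p i := by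
          refine Finset.sum_le_sum fun m hm => mul_le_mul_of_nonneg_left
            (h m (Finset.mem_Ico.1 hm).1) ?_
          have : (m : ℝ) ≤ M := by exact_mod_cast (Finset.mem_Ico.1 hm).2.le
          linarith
      _ = ∑ i, c i * W ^ s i * ∑ m ∈ Finset.Ico 1 M, ((M : ℝ) - m) * (m : ℝ) ^ p i := by
          simp_rw [Finset.mul_sum]
          rw [Finset.sum_comm]
          exact Finset.sum_congr rfl fun i _ => Finset.sum_congr rfl fun m _ => by ring
      _ ≤ _ := Finset.sum_le_sum fun i _ => mul_le_mul_of_nonneg_left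
          (sum_weight_mul_rpow_le (hp i) (hp1 i) M)
          (mul_nonneg (hc i) (Real.rpow_nonneg hW.le _))
  have hterm : ∀ i, W ^ κ * (2 / ((p i + 1) * (p i + 2)) * (c i * W ^ s i) * (M : ℝ) ^ p i)
      ≤ 2 / ((p i + 1) * (p i + 2)) * c i * R i * W ^ (κ + s i + κ * p i) := by
    intro i
    have hpow : (M : ℝ) ^ p i ≤ R i * W ^ (κ * p i) := by
      rcases hR i with ⟨h0, h1⟩ | ⟨h0, h1⟩
      · refine (Real.rpow_le_rpow_of_nonpos hηY hMlow h0).trans ?_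
        rw [Real.mul_rpow hη.le hY.le, ← Real.rpow_mul hW.le]
        gcongr
      · have h2 : (M : ℝ) ≤ (η + W ^ (-κ)) * W ^ κ := by rw [add_mul, hYinv]; exact hMhigh.le
        refine (Real.rpow_le_rpow hM0.le h2 h0).trans ?_
        rw [Real.mul_rpow (by positivity) hY.le, ← Real.rpow_mul hW.le]
        gcongr
    have hcoef : 0 ≤ 2 / ((p i + 1) * (p i + 2)) * (c i * W ^ s i) := by
      have h1 : 0 < p i + 1 := by linarith [hp i]
      have h2 : 0 < p i + 2 := by linarith [hp i]
      have := hc i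
      positivity
    rw [Real.rpow_add hW, Real.rpow_add hW]
    calc _ ≤ W ^ κ * (2 / ((p i + 1) * (p i + 2)) * (c i * W ^ s i) * (R i * W ^ (κ * p i))) := by
          gcongr
      _ = _ := by ring
  have hvdc := weyl_van_der_corput a L hM1
  have hlen : (L : ℝ) + M - 1 ≤ W ^ κ * (L * W ^ (-κ) + η) := by
    have : W ^ κ * (L * W ^ (-κ) + η) = L * (W ^ (-κ) * W ^ κ) + η * W ^ κ := by ring
    rw [this, hYinv]
    linarith
  have hM2 : (0 : ℝ) < (M : ℝ) ^ 2 := by positivity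
  have hinner : (M : ℝ) * L + 2 * ∑ m ∈ Finset.Ico 1 M,
      ((M : ℝ) - m) * ‖expSum (fun n => a (n + m) - a n) (L - m)‖
      ≤ (M : ℝ) ^ 2 * (L / M + ∑ i, 2 / ((p i + 1) * (p i + 2)) * (c i * W ^ s i)
        * (M : ℝ) ^ p i) := by
    have h1 : (M : ℝ) ^ 2 * ∑ i, 2 / ((p i + 1) * (p i + 2)) * (c i * W ^ s i) * (M : ℝ) ^ p i
        = 2 * ∑ i, c i * W ^ s i * ((M : ℝ) ^ (p i + 2) / ((p i + 1) * (p i + 2))) := by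
      rw [Finset.mul_sum, Finset.mul_sum]
      refine Finset.sum_congr rfl fun i _ => ?_
      rw [Real.rpow_add hM0, Real.rpow_two]
      ring
    rw [mul_add, h1]
    have h2 : (M : ℝ) ^ 2 * (L / M) = M * L := by field_simp
    linarith
  have hinner0 : 0 ≤ (L : ℝ) / M + ∑ i, 2 / ((p i + 1) * (p i + 2)) * (c i * W ^ s i)
      * (M : ℝ) ^ p i := by
    refine add_nonneg (by positivity) (Finset.sum_nonneg fun i _ => ?_)
    have h1 : 0 < p i + 1 := by linarith [hp i]
    have h2 : 0 < p i + 2 := by linarith [hp i]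
    have := hc i
    positivity
  have hlen0 : 0 ≤ (L : ℝ) + M - 1 := by
    have h1 : (1 : ℝ) ≤ M := by exact_mod_cast hM1
    have h2 : (0 : ℝ) ≤ L := Nat.cast_nonneg L
    linarith
  -- the factor `L + M - 1` is bounded from above with `M < η W ^ κ + 1`, while the powers of `M`
  -- are kept for `hterm`, which needs both bounds on `M`
  have hfin : ‖expSum a L‖ ^ 2 ≤ (W ^ κ * (L * W ^ (-κ) + η)) *
      (L / M + ∑ i, 2 / ((p i + 1) * (p i + 2)) * (c i * W ^ s i) * (M : ℝ) ^ p i) := by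
    refine le_of_mul_le_mul_left ?_ hM2
    refine hvdc.trans ((mul_le_mul_of_nonneg_left hinner hlen0).trans ?_)
    rw [mul_left_comm]
    gcongr
  refine hfin.trans ?_
  rw [mul_comm (W ^ κ), mul_assoc]
  refine mul_le_mul_of_nonneg_left ?_ (by positivity)
  rw [mul_add, Finset.mul_sum]
  refine add_le_add ?_ (Finset.sum_le_sum fun i _ => hterm i)
  rw [← mul_div_assoc, div_le_div_iff₀ hM0 hη]
  have hL0 : (0 : ℝ) ≤ L := Nat.cast_nonneg L
  nlinarith [mul_le_mul_of_nonneg_left hMlow hL0]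

/-- For `W ≤ 1` the bounds of all the tests are weaker than the trivial bound. -/
lemma norm_expSum_sq_le_of_le_one (a : ℕ → ℝ) (L : ℕ) {W κ η X : ℝ} (hW : 0 < W) (hW1 : W ≤ 1)
    (hκ : 0 ≤ κ) (hη : 0 ≤ η) (hX : (L : ℝ) ≤ X) :
    ‖expSum a L‖ ^ 2 ≤ (L * W ^ (-κ) + η) * X := by
  have h1 : 1 ≤ W ^ (-κ) := Real.one_le_rpow_of_pos_of_le_one_of_nonpos hW hW1 (by linarith)
  have h2 := norm_expSum_le a L
  have hL : (0 : ℝ) ≤ L := Nat.cast_nonneg L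
  have h3 : (L : ℝ) ≤ L * W ^ (-κ) + η := by nlinarith
  calc ‖expSum a L‖ ^ 2 ≤ (L : ℝ) ^ 2 := by gcongr
    _ = (L : ℝ) * L := sq _
    _ ≤ _ := by gcongr

/-! ### The third, fourth and fifth difference tests -/

lemma one_le_alphaTilde3 {η₃ lam : ℝ} (hη₃ : 0 < η₃) (hlam : 1 ≤ lam) :
    1 ≤ alphaTilde3 η₃ lam := by
  have : 0 ≤ 1 / η₃ + 32 * lam / (15 * √Real.pi) * √(η₃ + 1) + 2 * lam * η₃ := by positivity
  rw [alphaTilde3]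
  linarith

lemma betaTilde3_nonneg (η₃ : ℝ) : 0 ≤ betaTilde3 η₃ := by
  rw [betaTilde3]; positivity

lemma one_le_alphaTilde4 {η₃ η₄ lam : ℝ} (hη₃ : 0 < η₃) (hη₄ : 0 < η₄) (hlam : 1 ≤ lam) :
    1 ≤ alphaTilde4 η₃ η₄ lam := by
  have h0 : 2 ≤ alphaTilde3 η₃ lam := by
    have : 0 ≤ 1 / η₃ + 32 * lam / (15 * √Real.pi) * √(η₃ + 1) + 2 * lam * η₃ := by positivity
    rw [alphaTilde3]
    linarith
  have h1 : 1.4 ≤ √(alphaTilde3 η₃ lam) := Real.le_sqrt_of_sq_le (by norm_num; linarith)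
  have h2 : 1 ≤ (η₄ + 1) ^ (1 / 6 : ℝ) := Real.one_le_rpow (by linarith) (by norm_num)
  have h3 : 0 < 1 / η₄ := by positivity
  rw [alphaTilde4]
  nlinarith

lemma gammaTilde4_nonneg {η₃ η₄ lam : ℝ} (hη₄ : 0 < η₄) : 0 ≤ gammaTilde4 η₃ η₄ lam := by
  rw [gammaTilde4]; positivity

lemma beta4_nonneg {η₃ η₄ : ℝ} (hη₄ : 0 < η₄) : 0 ≤ beta4 η₃ η₄ := by
  rw [beta4]; positivity

/-- The second difference test, applied to a sequence differenced with shift `m`. -/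
lemma norm_expSum_shift_sub_le {a : ℕ → ℝ} {L : ℕ} {W lam : ℝ} (hW : 0 < W) (hlam : 1 ≤ lam)
    (h : DiffBounds 3 (1 / W) (lam / W) a L) {m : ℕ} (hm : 1 ≤ m) :
    ‖expSum (fun n => a (n + m) - a n) (L - m)‖ ≤
      4 * lam * L / √Real.pi * W ^ (-(1 / 2) : ℝ) * (m : ℝ) ^ (1 / 2 : ℝ)
        + 2 * lam * L * W ^ (-1 : ℝ) * (m : ℝ) ^ (1 : ℝ)
        + 8 / √Real.pi * W ^ (1 / 2 : ℝ) * (m : ℝ) ^ (-(1 / 2) : ℝ)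
        + 4 * W ^ (0 : ℝ) * (m : ℝ) ^ (0 : ℝ) := by
  have hm0 : (0 : ℝ) < m := by exact_mod_cast hm
  have hlam0 : 0 < lam := by linarith
  have h1 := second_difference_test (by positivity) (by gcongr) (h.shift_sub m)
  refine h1.trans ?_
  have hLm : ((L - m : ℕ) : ℝ) ≤ L := by exact_mod_cast Nat.sub_le L m
  calc _ ≤ (m * (lam / W) * L + 2) * (4 / √(Real.pi * (m * (1 / W))) + 2) := by gcongr
    _ = _ := by
      have hsW := Real.mul_self_sqrt hW.le
      have hsm := Real.mul_self_sqrt hm0.le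
      have hsW0 := Real.sqrt_pos.2 hW
      have hsm0 := Real.sqrt_pos.2 hm0
      rw [Real.sqrt_mul Real.pi_pos.le, Real.sqrt_mul hm0.le, one_div, Real.sqrt_inv,
        Real.rpow_neg hW.le, Real.rpow_neg hm0.le, Real.rpow_neg_one, Real.rpow_one,
        Real.rpow_zero, Real.rpow_zero, ← one_div, ← Real.sqrt_eq_rpow, ← Real.sqrt_eq_rpow]
      have hsp0 := Real.sqrt_pos.2 Real.pi_pos
      generalize √W = w at *
      generalize √(m : ℝ) = u at *
      rw [← hsW, ← hsm]
      field_simp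
      ring

/-- Third difference test, obtained from the second with `⌈η₃ W ^ (1 / 3)⌉` shifts. -/
lemma third_difference_test {a : ℕ → ℝ} {L : ℕ} {W lam η₃ : ℝ} (hW : 0 < W) (hlam : 1 ≤ lam)
    (hη₃ : 0 < η₃) (h : DiffBounds 3 (1 / W) (lam / W) a L) :
    ‖expSum a L‖ ^ 2 ≤ (L * W ^ (-(1 / 3) : ℝ) + η₃) *
      (alphaTilde3 η₃ lam * L + betaTilde3 η₃ * W ^ (2 / 3 : ℝ)) := by
  have hα := one_le_alphaTilde3 hη₃ hlam
  have hβ := betaTilde3_nonneg η₃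
  have hL : (0 : ℝ) ≤ L := Nat.cast_nonneg L
  have hlam0 : 0 < lam := by linarith
  rcases le_total W 1 with hW1 | hW1
  · refine norm_expSum_sq_le_of_le_one a L hW hW1 (by norm_num) hη₃.le ?_
    have : 0 ≤ betaTilde3 η₃ * W ^ (2 / 3 : ℝ) := by positivity
    nlinarith
  have hstep := differencing_step (a := a) (L := L) (κ := 1 / 3) (η := η₃) hW hη₃
    ![4 * lam * L / √Real.pi, 2 * lam * L, 8 / √Real.pi, 4]
    ![-(1 / 2), -1, 1 / 2, 0] ![1 / 2, 1, -(1 / 2), 0]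
    ![(η₃ + W ^ (-(1 / 3) : ℝ)) ^ (1 / 2 : ℝ), (η₃ + W ^ (-(1 / 3) : ℝ)) ^ (1 : ℝ),
      η₃ ^ (-(1 / 2) : ℝ), 1]
    (fun i => by fin_cases i <;> simp <;> positivity)
    (fun i => by fin_cases i <;> norm_num)
    (fun i => by fin_cases i <;> norm_num)
    (fun i => by fin_cases i <;> norm_num)
    (fun m hm => by
      simpa [Fin.sum_univ_succ, add_assoc] using norm_expSum_shift_sub_le hW hlam h hm)
  refine hstep.trans (mul_le_mul_of_nonneg_left ?_ (by positivity))
  simp only [Fin.sum_univ_four, Matrix.cons_val]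
  norm_num only
  have hd : W ^ (-(1 / 3) : ℝ) ≤ 1 := Real.rpow_le_one_of_one_le_of_nonpos hW1 (by norm_num)
  have e1 : (η₃ + W ^ (-(1 / 3) : ℝ)) ^ (1 / 2 : ℝ) ≤ √(η₃ + 1) := by
    rw [Real.sqrt_eq_rpow]; gcongr
  have e2 : (η₃ + W ^ (-(1 / 3) : ℝ)) ^ (1 : ℝ) ≤ η₃ + 1 := by
    rw [Real.rpow_one]; gcongr
  have e3 : η₃ ^ (-(1 / 2) : ℝ) = 1 / √η₃ := by
    rw [Real.rpow_neg hη₃.le, Real.sqrt_eq_rpow, ← one_div]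
  have e4 : W ^ (1 / 3 : ℝ) ≤ W ^ (2 / 3 : ℝ) := Real.rpow_le_rpow_of_exponent_le hW1 (by norm_num)
  have e5 : 1 / 3 * (2 * lam * L) * (η₃ + W ^ (-(1 / 3) : ℝ)) ^ (1 : ℝ) * W ^ (-(1 / 3) : ℝ)
      ≤ 1 * (2 * lam * L) * (η₃ + 1) * 1 := by gcongr; norm_num
  calc _ ≤ L / η₃ + (8 / 15 * (4 * lam * L / √Real.pi) * √(η₃ + 1) * W ^ (0 : ℝ)
          + 1 * (2 * lam * L) * (η₃ + 1) * 1
          + 8 / 3 * (8 / √Real.pi) * (1 / √η₃) * W ^ (2 / 3 : ℝ) + 4 * W ^ (2 / 3 : ℝ)) := by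
        rw [e3]; gcongr
    _ = _ := by
        rw [alphaTilde3, betaTilde3, Real.rpow_zero]
        field_simp
        ring

lemma sqrt_add_le {x y : ℝ} (hx : 0 ≤ x) (hy : 0 ≤ y) : √(x + y) ≤ √x + √y := by
  refine Real.sqrt_le_iff.2 ⟨by positivity, ?_⟩
  have : 0 ≤ √x * √y := by positivity
  nlinarith [Real.sq_sqrt hx, Real.sq_sqrt hy]

lemma sqrt_div_rpow {W m s t : ℝ} (hW : 0 < W) (hm : 0 < m) (hs : s = 2 * t) :
    √((W / m) ^ s) = W ^ t * m ^ (-t) := by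
  rw [Real.sqrt_eq_rpow, ← Real.rpow_mul (by positivity), Real.div_rpow hW.le hm.le,
    Real.rpow_neg hm.le, hs, div_eq_mul_inv]
  ring_nf

/-- The third difference test, applied to a sequence differenced with shift `m`. -/
lemma norm_expSum_shift_sub_le_of_four {a : ℕ → ℝ} {L : ℕ} {W lam η₃ : ℝ} (hW : 0 < W)
    (hlam : 1 ≤ lam) (hη₃ : 0 < η₃) (h : DiffBounds 4 (1 / W) (lam / W) a L) {m : ℕ}
    (hm : 1 ≤ m) :
    ‖expSum (fun n => a (n + m) - a n) (L - m)‖ ≤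
      √(alphaTilde3 η₃ lam) * L * W ^ (-(1 / 6) : ℝ) * (m : ℝ) ^ (1 / 6 : ℝ)
        + √(betaTilde3 η₃) * √L * W ^ (1 / 6 : ℝ) * (m : ℝ) ^ (-(1 / 6) : ℝ)
        + √(η₃ * alphaTilde3 η₃ lam) * √L * W ^ (0 : ℝ) * (m : ℝ) ^ (0 : ℝ)
        + √(betaTilde3 η₃ * η₃) * W ^ (1 / 3 : ℝ) * (m : ℝ) ^ (-(1 / 3) : ℝ) := by
  have hm0 : (0 : ℝ) < m := by exact_mod_cast hm
  have hα := one_le_alphaTilde3 hη₃ hlam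
  have hβ := betaTilde3_nonneg η₃
  have hL : (0 : ℝ) ≤ L := Nat.cast_nonneg L
  have hd : DiffBounds 3 (1 / (W / m)) (lam / (W / m)) (fun n => a (n + m) - a n) (L - m) := by
    have := h.shift_sub m
    rwa [show m * (1 / W) = 1 / (W / m) by field_simp,
      show m * (lam / W) = lam / (W / m) by field_simp] at this
  have h1 := third_difference_test (by positivity) hlam hη₃ hd
  have hLm : ((L - m : ℕ) : ℝ) ≤ L := by exact_mod_cast Nat.sub_le L m
  have h2 : ‖expSum (fun n => a (n + m) - a n) (L - m)‖ ^ 2 ≤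
      (L * (W / m) ^ (-(1 / 3) : ℝ) + η₃) *
        (alphaTilde3 η₃ lam * L + betaTilde3 η₃ * (W / m) ^ (2 / 3 : ℝ)) := by
    refine h1.trans ?_
    gcongr
  refine (Real.le_sqrt_of_sq_le h2).trans ?_
  rw [Real.sqrt_mul (by positivity)]
  calc _ ≤ (√(L * (W / m) ^ (-(1 / 3) : ℝ)) + √η₃) *
        (√(alphaTilde3 η₃ lam * L) + √(betaTilde3 η₃ * (W / m) ^ (2 / 3 : ℝ))) := by
        gcongr <;> exact sqrt_add_le (by positivity) (by positivity)
    _ = _ := by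
      have w1 : W ^ (1 / 6 : ℝ) = W ^ (-(1 / 6) : ℝ) * W ^ (1 / 3 : ℝ) := by
        rw [← Real.rpow_add hW]; norm_num
      have m1 : (m : ℝ) ^ (-(1 / 6) : ℝ) = (m : ℝ) ^ (1 / 6 : ℝ) * (m : ℝ) ^ (-(1 / 3) : ℝ) := by
        rw [← Real.rpow_add hm0]; norm_num
      rw [Real.sqrt_mul hL, Real.sqrt_mul (by linarith), Real.sqrt_mul hβ, Real.sqrt_mul hη₃.le,
        Real.sqrt_mul hβ, sqrt_div_rpow hW hm0 (t := -(1 / 6)) (by norm_num),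
        sqrt_div_rpow hW hm0 (t := 1 / 3) (by norm_num), w1, m1, neg_neg, Real.rpow_zero,
        Real.rpow_zero]
      linear_combination √(alphaTilde3 η₃ lam) * W ^ (-(1 / 6) : ℝ) * (m : ℝ) ^ (1 / 6 : ℝ)
        * Real.mul_self_sqrt hL

/-- Fourth difference test, obtained from the third with `⌈η₄ W ^ (1 / 7)⌉` shifts. -/
lemma fourth_difference_test {a : ℕ → ℝ} {L : ℕ} {W lam η₃ η₄ : ℝ} (hW : 0 < W)
    (hlam : 1 ≤ lam) (hη₃ : 0 < η₃) (hη₄ : 0 < η₄) (h : DiffBounds 4 (1 / W) (lam / W) a L) :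
    ‖expSum a L‖ ^ 2 ≤ (L * W ^ (-(1 / 7) : ℝ) + η₄) *
      (alphaTilde4 η₃ η₄ lam * L + gammaTilde4 η₃ η₄ lam * √L * W ^ (2 / 7 : ℝ)
        + beta4 η₃ η₄ * W ^ (3 / 7 : ℝ)) := by
  have hα := one_le_alphaTilde4 hη₃ hη₄ hlam
  have hγ := gammaTilde4_nonneg (η₃ := η₃) (lam := lam) hη₄
  have hβ := beta4_nonneg (η₃ := η₃) hη₄
  have hL : (0 : ℝ) ≤ L := Nat.cast_nonneg L
  rcases le_total W 1 with hW1 | hW1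
  · refine norm_expSum_sq_le_of_le_one a L hW hW1 (by norm_num) hη₄.le ?_
    have h1 : 0 ≤ gammaTilde4 η₃ η₄ lam * √L * W ^ (2 / 7 : ℝ) := by positivity
    have h2 : 0 ≤ beta4 η₃ η₄ * W ^ (3 / 7 : ℝ) := by positivity
    nlinarith
  have hstep := differencing_step (a := a) (L := L) (κ := 1 / 7) (η := η₄) hW hη₄
    ![√(alphaTilde3 η₃ lam) * L, √(betaTilde3 η₃) * √L, √(η₃ * alphaTilde3 η₃ lam) * √L,
      √(betaTilde3 η₃ * η₃)]
    ![-(1 / 6), 1 / 6, 0, 1 / 3] ![1 / 6, -(1 / 6), 0, -(1 / 3)]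
    ![(η₄ + W ^ (-(1 / 7) : ℝ)) ^ (1 / 6 : ℝ), η₄ ^ (-(1 / 6) : ℝ), 1, η₄ ^ (-(1 / 3) : ℝ)]
    (fun i => by fin_cases i <;> simp <;> positivity)
    (fun i => by fin_cases i <;> norm_num)
    (fun i => by fin_cases i <;> norm_num)
    (fun i => by fin_cases i <;> norm_num)
    (fun m hm => by
      simpa [Fin.sum_univ_succ, add_assoc] using norm_expSum_shift_sub_le_of_four hW hlam hη₃ h hm)
  refine hstep.trans (mul_le_mul_of_nonneg_left ?_ (by positivity))
  simp only [Fin.sum_univ_four, Matrix.cons_val]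
  norm_num only
  have hd : W ^ (-(1 / 7) : ℝ) ≤ 1 := Real.rpow_le_one_of_one_le_of_nonpos hW1 (by norm_num)
  have e1 : W ^ (1 / 7 : ℝ) ≤ W ^ (2 / 7 : ℝ) := Real.rpow_le_rpow_of_exponent_le hW1 (by norm_num)
  calc _ ≤ L / η₄ + (72 / 91 * (√(alphaTilde3 η₃ lam) * L) * (η₄ + 1) ^ (1 / 6 : ℝ) * W ^ (0 : ℝ)
          + 72 / 55 * (√(betaTilde3 η₃) * √L) * η₄ ^ (-(1 / 6) : ℝ) * W ^ (2 / 7 : ℝ)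
          + 1 * (√(η₃ * alphaTilde3 η₃ lam) * √L) * 1 * W ^ (2 / 7 : ℝ)
          + 9 / 5 * √(betaTilde3 η₃ * η₃) * η₄ ^ (-(1 / 3) : ℝ) * W ^ (3 / 7 : ℝ)) := by
        gcongr
    _ = _ := by
        rw [alphaTilde4, gammaTilde4, beta4, Real.rpow_zero]
        ring

/-- The fourth difference test, applied to a sequence differenced with shift `m`. -/
lemma norm_expSum_shift_sub_le_of_five {a : ℕ → ℝ} {L : ℕ} {W lam η₃ η₄ : ℝ} (hW : 0 < W)
    (hlam : 1 ≤ lam) (hη₃ : 0 < η₃) (hη₄ : 0 < η₄) (h : DiffBounds 5 (1 / W) (lam / W) a L) {m : ℕ}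
    (hm : 1 ≤ m) :
    ‖expSum (fun n => a (n + m) - a n) (L - m)‖ ≤
      √(alphaTilde4 η₃ η₄ lam) * L * W ^ (-(1 / 14) : ℝ) * (m : ℝ) ^ (1 / 14 : ℝ)
        + √(gammaTilde4 η₃ η₄ lam) * (L : ℝ) ^ (3 / 4 : ℝ) * W ^ (1 / 14 : ℝ)
          * (m : ℝ) ^ (-(1 / 14) : ℝ)
        + √(beta4 η₃ η₄) * √L * W ^ (1 / 7 : ℝ) * (m : ℝ) ^ (-(1 / 7) : ℝ)
        + √(η₄ * alphaTilde4 η₃ η₄ lam) * √L * W ^ (0 : ℝ) * (m : ℝ) ^ (0 : ℝ)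
        + √(η₄ * gammaTilde4 η₃ η₄ lam) * (L : ℝ) ^ (1 / 4 : ℝ) * W ^ (1 / 7 : ℝ)
          * (m : ℝ) ^ (-(1 / 7) : ℝ)
        + √(η₄ * beta4 η₃ η₄) * W ^ (3 / 14 : ℝ) * (m : ℝ) ^ (-(3 / 14) : ℝ) := by
  have hm0 : (0 : ℝ) < m := by exact_mod_cast hm
  have hα := one_le_alphaTilde4 hη₃ hη₄ hlam
  have hγ := gammaTilde4_nonneg (η₃ := η₃) (lam := lam) hη₄
  have hβ := beta4_nonneg (η₃ := η₃) hη₄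
  have hL : (0 : ℝ) ≤ L := Nat.cast_nonneg L
  have hd : DiffBounds 4 (1 / (W / m)) (lam / (W / m)) (fun n => a (n + m) - a n) (L - m) := by
    have := h.shift_sub m
    rwa [show m * (1 / W) = 1 / (W / m) by field_simp,
      show m * (lam / W) = lam / (W / m) by field_simp] at this
  have h1 := fourth_difference_test (by positivity) hlam hη₃ hη₄ hd
  have hLm : ((L - m : ℕ) : ℝ) ≤ L := by exact_mod_cast Nat.sub_le L m
  have h2 : ‖expSum (fun n => a (n + m) - a n) (L - m)‖ ^ 2 ≤
      (L * (W / m) ^ (-(1 / 7) : ℝ) + η₄) *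
        (alphaTilde4 η₃ η₄ lam * L + gammaTilde4 η₃ η₄ lam * √L * (W / m) ^ (2 / 7 : ℝ)
          + beta4 η₃ η₄ * (W / m) ^ (3 / 7 : ℝ)) := by
    refine h1.trans ?_
    gcongr
  refine (Real.le_sqrt_of_sq_le h2).trans ?_
  rw [Real.sqrt_mul (by positivity)]
  calc _ ≤ (√(L * (W / m) ^ (-(1 / 7) : ℝ)) + √η₄) *
        (√(alphaTilde4 η₃ η₄ lam * L) + √(gammaTilde4 η₃ η₄ lam * √L * (W / m) ^ (2 / 7 : ℝ))
          + √(beta4 η₃ η₄ * (W / m) ^ (3 / 7 : ℝ))) := by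
        gcongr
        · exact sqrt_add_le (by positivity) (by positivity)
        · refine (sqrt_add_le (by positivity) (by positivity)).trans ?_
          gcongr
          exact sqrt_add_le (by positivity) (by positivity)
    _ = _ := by
      have w1 : W ^ (1 / 14 : ℝ) = W ^ (-(1 / 14) : ℝ) * W ^ (1 / 7 : ℝ) := by
        rw [← Real.rpow_add hW]; norm_num
      have m1 : (m : ℝ) ^ (-(1 / 14) : ℝ) = (m : ℝ) ^ (1 / 14 : ℝ) * (m : ℝ) ^ (-(1 / 7) : ℝ) := by
        rw [← Real.rpow_add hm0]; norm_num
      have w2 : W ^ (-(1 / 14) : ℝ) * W ^ (3 / 14 : ℝ) = W ^ (1 / 7 : ℝ) := by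
        rw [← Real.rpow_add hW]; norm_num
      have m2 : (m : ℝ) ^ (1 / 14 : ℝ) * (m : ℝ) ^ (-(3 / 14) : ℝ) = (m : ℝ) ^ (-(1 / 7) : ℝ) := by
        rw [← Real.rpow_add hm0]; norm_num
      have l1 : √√(L : ℝ) = (L : ℝ) ^ (1 / 4 : ℝ) := by
        rw [Real.sqrt_eq_rpow, Real.sqrt_eq_rpow, ← Real.rpow_mul hL]; norm_num
      have l2 : (L : ℝ) ^ (3 / 4 : ℝ) = √L * (L : ℝ) ^ (1 / 4 : ℝ) := by
        rw [Real.sqrt_eq_rpow, ← Real.rpow_add_of_nonneg hL (by norm_num) (by norm_num)]; norm_num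
      rw [Real.sqrt_mul hL, Real.sqrt_mul (by linarith), Real.sqrt_mul (by positivity),
        Real.sqrt_mul hγ, Real.sqrt_mul hβ, Real.sqrt_mul hη₄.le, Real.sqrt_mul hη₄.le,
        Real.sqrt_mul hη₄.le, sqrt_div_rpow hW hm0 (t := -(1 / 14)) (by norm_num),
        sqrt_div_rpow hW hm0 (t := 1 / 7) (by norm_num),
        sqrt_div_rpow hW hm0 (t := 3 / 14) (by norm_num), l1, l2, w1, m1, neg_neg, Real.rpow_zero,
        Real.rpow_zero]
      have l3 := Real.mul_self_sqrt hL
      linear_combination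
        √(alphaTilde4 η₃ η₄ lam) * W ^ (-(1 / 14) : ℝ) * (m : ℝ) ^ (1 / 14 : ℝ) * l3
        + √(beta4 η₃ η₄) * √L * ((m : ℝ) ^ (1 / 14 : ℝ) * (m : ℝ) ^ (-(3 / 14) : ℝ)) * w2
        + √(beta4 η₃ η₄) * √L * W ^ (1 / 7 : ℝ) * m2

/-- Fifth difference test, obtained from the fourth with `⌈η₅ W ^ (1 / 15)⌉` shifts. -/
lemma fifth_difference_test {a : ℕ → ℝ} {L : ℕ} {W lam η₃ η₄ η₅ : ℝ} (hW : 0 < W)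
    (hlam : 1 ≤ lam) (hη₃ : 0 < η₃) (hη₄ : 0 < η₄) (hη₅ : 0 < η₅)
    (h : DiffBounds 5 (1 / W) (lam / W) a L) :
    ‖expSum a L‖ ^ 2 ≤ (L * W ^ (-(1 / 15) : ℝ) + η₅) *
      (alpha5 η₃ η₄ η₅ lam W * L + tau5 η₃ η₄ η₅ lam * (L : ℝ) ^ (3 / 4 : ℝ) * W ^ (2 / 15 : ℝ)
        + gamma5 η₃ η₄ η₅ lam W * √L * W ^ (3 / 15 : ℝ)
        + omega5 η₃ η₄ η₅ lam * (L : ℝ) ^ (1 / 4 : ℝ) * W ^ (1 / 5 : ℝ)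
        + beta5 η₃ η₄ η₅ * W ^ (4 / 15 : ℝ)) := by
  have hstep := differencing_step (a := a) (L := L) (κ := 1 / 15) (η := η₅) hW hη₅
    ![√(alphaTilde4 η₃ η₄ lam) * L, √(gammaTilde4 η₃ η₄ lam) * (L : ℝ) ^ (3 / 4 : ℝ),
      √(beta4 η₃ η₄) * √L, √(η₄ * alphaTilde4 η₃ η₄ lam) * √L,
      √(η₄ * gammaTilde4 η₃ η₄ lam) * (L : ℝ) ^ (1 / 4 : ℝ), √(η₄ * beta4 η₃ η₄)]
    ![-(1 / 14), 1 / 14, 1 / 7, 0, 1 / 7, 3 / 14]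
    ![1 / 14, -(1 / 14), -(1 / 7), 0, -(1 / 7), -(3 / 14)]
    ![(η₅ + W ^ (-(1 / 15) : ℝ)) ^ (1 / 14 : ℝ), η₅ ^ (-(1 / 14) : ℝ), η₅ ^ (-(1 / 7) : ℝ), 1,
      η₅ ^ (-(1 / 7) : ℝ), η₅ ^ (-(3 / 14) : ℝ)]
    (fun i => by fin_cases i <;> simp <;> positivity)
    (fun i => by fin_cases i <;> norm_num)
    (fun i => by fin_cases i <;> norm_num)
    (fun i => by fin_cases i <;> norm_num)
    (fun m hm => by
      simpa [Fin.sum_univ_succ, add_assoc]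
        using norm_expSum_shift_sub_le_of_five hW hlam hη₃ hη₄ h hm)
  refine hstep.trans_eq ?_
  congr 1
  simp only [Fin.sum_univ_six, Matrix.cons_val]
  norm_num only
  have w1 : W ^ (-(2 / 15) : ℝ) * W ^ (1 / 5 : ℝ) = W ^ (1 / 15 : ℝ) := by
    rw [← Real.rpow_add hW]; norm_num
  rw [alpha5, tau5, gamma5, omega5, beta5, Real.rpow_zero]
  linear_combination (-√(η₄ * alphaTilde4 η₃ η₄ lam) * √L) * w1

/-! ### From derivatives to differences -/

/-- Mean value theorem for forward differences; `F i` plays the role of the `i`-th derivative. -/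
lemma fwdDiff_iter_mem_of_hasDerivWithinAt {u A B : ℝ} (k : ℕ) :
    ∀ (v : ℝ) (F : ℕ → ℝ → ℝ),
      (∀ i < k, ∀ x ∈ Set.Icc u v, HasDerivWithinAt (F i) (F (i + 1) x) (Set.Icc u v) x) →
      (∀ x ∈ Set.Icc u v, A ≤ F k x ∧ F k x ≤ B) →
      ∀ n : ℕ, u + n + k ≤ v →
        A ≤ (fwdDiff 1)^[k] (fun n : ℕ => F 0 (u + n)) n ∧
          (fwdDiff 1)^[k] (fun n : ℕ => F 0 (u + n)) n ≤ B := by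
  induction k with
  | zero =>
    intro v F _ hF n hn
    have hn0 : (0 : ℝ) ≤ n := Nat.cast_nonneg n
    simpa using hF (u + n) ⟨by linarith, by simpa using hn⟩
  | succ k ih =>
    intro v F hd hF n hn
    have hn' : u + n + k ≤ v - 1 := by push_cast at hn; linarith
    have hmem : ∀ x ∈ Set.Icc u (v - 1), x ∈ Set.Icc u v ∧ x + 1 ∈ Set.Icc u v := fun x hx =>
      ⟨⟨hx.1, by linarith [hx.2]⟩, ⟨by linarith [hx.1], by linarith [hx.2]⟩⟩
    have key := ih (v - 1) (fun i x => F i (x + 1) - F i x) ?_ ?_ n hn'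
    · have h0 : (fun n : ℕ => F 0 (u + n + 1) - F 0 (u + n))
          = fwdDiff 1 (fun n : ℕ => F 0 (u + n)) := by
        ext j
        simp [fwdDiff, add_assoc]
      rw [h0] at key
      rwa [Function.iterate_succ_apply]
    · intro i hi x hx
      refine HasDerivWithinAt.sub ?_ ((hd i (by omega) x (hmem x hx).1).mono
        fun y hy => (hmem y hy).1)
      have h1 := (hd i (by omega) (x + 1) (hmem x hx).2).comp x
        ((hasDerivWithinAt_id x (Set.Icc u (v - 1))).add_const 1) fun y hy => (hmem y hy).2
      simpa [Function.comp_def] using h1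
    · intro x hx
      have hsub : ∀ y ∈ Set.Icc x (x + 1), y ∈ Set.Icc u v := fun y hy =>
        ⟨hx.1.trans hy.1, by linarith [hy.2, hx.2]⟩
      obtain ⟨ξ, hξ, hξ'⟩ := exists_hasDerivAt_eq_slope (F k) (F (k + 1)) (lt_add_one x)
        (fun y hy => ((hd k (by omega) y (hsub y hy)).continuousWithinAt).mono hsub)
        (fun y hy => (hd k (by omega) y (hsub y (Set.Ioo_subset_Icc_self hy))).hasDerivAt
          (Icc_mem_nhds (by linarith [hx.1, hy.1]) (by linarith [hx.2, hy.2])))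
      rw [add_sub_cancel_left, div_one] at hξ'
      rw [← hξ']
      exact hF ξ (hsub ξ (Set.Ioo_subset_Icc_self hξ))

lemma expSum_neg (a : ℕ → ℝ) (L : ℕ) : ‖expSum (fun n => -a n) L‖ = ‖expSum a L‖ := by
  rw [← Complex.norm_conj (expSum a L), expSum, expSum, map_sum]
  simp only [e_neg]

/-- A continuous function with `|g| ≥ c > 0` on an interval has constant sign there. -/
lemma forall_le_or_forall_le_neg {g : ℝ → ℝ} {u v c : ℝ} (hc : 0 < c)
    (hg : ContinuousOn g (Set.Icc u v)) (h : ∀ x ∈ Set.Icc u v, c ≤ |g x|) :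
    (∀ x ∈ Set.Icc u v, c ≤ g x) ∨ (∀ x ∈ Set.Icc u v, c ≤ -g x) := by
  by_contra! hcon
  obtain ⟨⟨x, hx, hgx⟩, ⟨y, hy, hgy⟩⟩ := hcon
  have hgx' : g x ≤ 0 := by
    rcases le_abs.1 (h x hx) with h1 | h1 <;> linarith
  have hgy' : 0 ≤ g y := by
    rcases le_abs.1 (h y hy) with h1 | h1 <;> linarith
  obtain ⟨z, hz, hgz⟩ := isPreconnected_Icc.intermediate_value hx hy hg ⟨hgx', hgy'⟩
  have := h z hz
  rw [hgz, abs_zero] at this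
  linarith

/-- The samples of `f`, or those of `-f`, satisfy the hypothesis of the fifth difference test. -/
lemma diffBounds_or_diffBounds_neg {f : ℝ → ℝ} {u A B : ℝ} {L : ℕ} (hA : 0 < A)
    (hf : ContDiffOn ℝ 5 f (Set.Icc u (u + L - 1)))
    (hf5 : 2 ≤ L → ∀ x ∈ Set.Icc u (u + L - 1),
      A ≤ |iteratedDerivWithin 5 f (Set.Icc u (u + L - 1)) x| ∧
        |iteratedDerivWithin 5 f (Set.Icc u (u + L - 1)) x| ≤ B) :
    DiffBounds 5 A B (fun n => f (u + n)) L ∨ DiffBounds 5 A B (fun n => -f (u + n)) L := by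
  rcases lt_or_ge L 2 with hL | hL
  · exact Or.inl fun n hn => by omega
  have hL' : (2 : ℝ) ≤ L := by exact_mod_cast hL
  set s := Set.Icc u (u + L - 1) with hs
  have hud : UniqueDiffOn ℝ s := uniqueDiffOn_Icc (by linarith)
  have hder : ∀ i < 5, ∀ x ∈ s, HasDerivWithinAt (iteratedDerivWithin i f s)
      (iteratedDerivWithin (i + 1) f s x) s x := fun i hi x hx => by
    rw [iteratedDerivWithin_succ]
    exact (hf.differentiableOn_iteratedDerivWithin (by exact_mod_cast hi) hud x hx).hasDerivWithinAt
  have hcont := hf.continuousOn_iteratedDerivWithin (m := 5) le_rfl hud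
  have hrange : ∀ n : ℕ, n + 5 < L → u + n + (5 : ℕ) ≤ u + L - 1 := fun n hn => by
    have : ((n + 5 + 1 : ℕ) : ℝ) ≤ L := by exact_mod_cast hn
    push_cast at this ⊢
    linarith
  rcases forall_le_or_forall_le_neg hA hcont fun x hx => (hf5 hL x hx).1 with h | h
  · left
    intro n hn
    simpa using fwdDiff_iter_mem_of_hasDerivWithinAt 5 (u + L - 1)
      (fun i => iteratedDerivWithin i f s) hder
      (fun x hx => ⟨h x hx, (le_abs_self _).trans (hf5 hL x hx).2⟩) n (hrange n hn)
  · right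
    intro n hn
    simpa using fwdDiff_iter_mem_of_hasDerivWithinAt 5 (u + L - 1)
      (fun i x => -iteratedDerivWithin i f s x) (fun i hi x hx => (hder i hi x hx).neg)
      (fun x hx => ⟨h x hx, (neg_le_abs _).trans (hf5 hL x hx).2⟩) n (hrange n hn)

lemma sum_Icc_eq_expSum (N : ℤ) (L : ℕ) (f : ℝ → ℝ) :
    ∑ n ∈ Finset.Icc (N + 1) (N + (L : ℤ)),
        Complex.exp (2 * (Real.pi : ℂ) * Complex.I * ((f (n : ℝ) : ℝ) : ℂ))
      = expSum (fun n => f ((N : ℝ) + 1 + n)) L := by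
  symm
  refine Finset.sum_bij (fun n _ => N + 1 + (n : ℤ)) ?_ ?_ ?_ ?_
  · intro n hn
    have := Finset.mem_range.1 hn
    exact Finset.mem_Icc.2 (by omega)
  · intro n _ m _ h
    simpa using h
  · intro k hk
    have := Finset.mem_Icc.1 hk
    exact ⟨(k - (N + 1)).toNat, Finset.mem_range.2 (by omega), by omega⟩
  · intro n _
    simp [e]

end FifthDerivativeTest

theorem mainTheorem3 (N : ℤ) (L : ℕ) (f : ℝ → ℝ) (W₅ lam₅ η₃ η₄ η₅ : ℝ)
    (hW : 1 < W₅) (hlam : 1 ≤ lam₅) (hη₃ : 0 < η₃) (hη₄ : 0 < η₄) (hη₅ : 0 < η₅)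
    (hf : ContDiffOn ℝ 5 f (Set.Icc ((N : ℝ) + 1) ((N : ℝ) + L)))
    -- on a one-point interval (`L = 1`) the fifth derivative has no meaning and nothing is assumed
    (hf5 : 2 ≤ L → ∀ x ∈ Set.Icc ((N : ℝ) + 1) ((N : ℝ) + L),
      1 / W₅ ≤ |iteratedDerivWithin 5 f (Set.Icc ((N : ℝ) + 1) ((N : ℝ) + L)) x| ∧
        |iteratedDerivWithin 5 f (Set.Icc ((N : ℝ) + 1) ((N : ℝ) + L)) x| ≤ lam₅ / W₅) :
    ‖∑ n ∈ Finset.Icc (N + 1) (N + (L : ℤ)),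
        Complex.exp (2 * (Real.pi : ℂ) * Complex.I * ((f (n : ℝ) : ℝ) : ℂ))‖ ^ 2 ≤
      ((L : ℝ) * W₅ ^ (-(1 / 15) : ℝ) + η₅) *
        (FifthDerivativeTest.alpha5 η₃ η₄ η₅ lam₅ W₅ * (L : ℝ)
          + FifthDerivativeTest.tau5 η₃ η₄ η₅ lam₅ * (L : ℝ) ^ (3 / 4 : ℝ) * W₅ ^ (2 / 15 : ℝ)
          + FifthDerivativeTest.gamma5 η₃ η₄ η₅ lam₅ W₅ * √(L : ℝ) * W₅ ^ (3 / 15 : ℝ)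
          + FifthDerivativeTest.omega5 η₃ η₄ η₅ lam₅ * (L : ℝ) ^ (1 / 4 : ℝ) * W₅ ^ (1 / 5 : ℝ)
          + FifthDerivativeTest.beta5 η₃ η₄ η₅ * W₅ ^ (4 / 15 : ℝ)) := by
  have hlen : (N : ℝ) + L = (N : ℝ) + 1 + L - 1 := by ring
  rw [hlen] at hf hf5
  rw [FifthDerivativeTest.sum_Icc_eq_expSum]
  rcases FifthDerivativeTest.diffBounds_or_diffBounds_neg (by positivity) hf hf5 with h | h
  · exact FifthDerivativeTest.fifth_difference_test (by linarith) hlam hη₃ hη₄ hη₅ h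
  · rw [← FifthDerivativeTest.expSum_neg]
    exact FifthDerivativeTest.fifth_difference_test (by linarith) hlam hη₃ hη₄ hη₅ h
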